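/- Let $\mathcal H=(V,\mathcal E)$ be a finite hypergraph in which each hyperedge $e$ has a scale $c_e\ge 0$, a threshold $\delta_e\ge 1$ and the splitting function $f_e(A)=c_e\min\{|A|,|e\setminus A|,\delta_e\}$ for $A\subseteq e$. Put $d_v=\sum_{e\ni v}f_e(\{v\})$, $\mathbf{vol}(S)=\sum_{v\in S}d_v$, $\mathbf{vol}(\mathcal H)=\mathbf{vol}(V)$, $\bar S=V\setminus S$, $\mathbf{cut}(S)=\sum_{e}f_e(e\cap S)$, and $\phi_{\mathcal H}(S)=\mathbf{cut}(S)/\min\{\mathbf{vol}(S),\mathbf{vol}(\bar S)\}$ whenever $\mathbf{vol}(S)$ and $\mathbf{vol}(\bar S)$ are positive. For $\gamma>0$ and a seed set $R\subseteq V$, the localized directed cut graph has the nodes $V$, two auxiliary nodes $a_e,b_e$ for each hyperedge $e$, a source $s$ and a sink $t$. Its edges are $v\to a_e$ and $b_e\to v$ of weight $c_e$ for each $e$ and $v\in e$; $a_e\to b_e$ of weight $c_e\delta_e$ for each $e$; $s\to r$ of weight $\gamma d_r$ for $r\in R$; and $v\to t$ of weight $\gamma d_v$ for $v\in V\setminus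 R$. Writing $w_{ij}$ for the weight of the edge $i\to j$, let $x(\gamma,R)$ be a solution of $$\min_x\ \tfrac12\sum_{i\to j}w_{ij}\,\bigl(\max\{x_i-x_j,0\}\bigr)^2\quad\text{subject to } x_s=1,\ x_t=0,\ x\ge 0$$ (the local hypergraph quadratic diffusion with $\kappa=0$). The sweep cut over $x$ orders $V$ by decreasing $x_v$, ties being broken arbitrarily, and returns a set of minimum conductance among the prefixes $T$ of this order with $\mathbf{vol}(T)>0$ and $\mathbf{vol}(\bar T)>0$. Let $\gamma,c>0$, and let $S^*\subseteq V$ satisfy $0<\mathbf{vol}(S^*)\le\mathbf{vol}(\mathcal H)/2$ and $\phi_{\mathcal H}(S^*)\le\gamma/(8c)$. Let $\mathbb P$ be a good sampling strategy with constant $c$ for $S^*$, that is, a probability distribution on the vertices of positive degree such that $$\mathbb E_{v\sim\mathbb P}\Bigl[\frac1{d_v}\sum_{u\in V\setminus S^*}d_u\,x_u(\gamma,\{v\})\Bigr]\le\frac{c}{\mathbf{vol}(S^*)}\sum_{u\in V\setminus S^*}d_u\,x_u(\gamma,S^*).$$ Then, with probability at least $1/2$ over the seed $v\sim\mathbb P$,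 the sweep cut over $x(\gamma,\{v\})$ returns a set, and every set $S_x$ that it can return satisfies $$\phi_{\mathcal H}(S_x)\le\bar\delta\,\sqrt{32\,\gamma\,\ln\bigl(100\,\mathbf{vol}(S^*)/d_v\bigr)},\qquad \bar\delta=\max_{e\in\partial S_x}\min\{\delta_e,|e|/2\},$$ where $\partial S_x=\{e\in\mathcal E: e\cap S_x\ne\emptyset,\ e\cap\bar S_x\ne\emptyset\}$ (and $\bar\delta=0$ if $\partial S_x=\emptyset$, in which case $\phi_{\mathcal H}(S_x)=0$). -/

import Mathlib

/-- A finite hypergraph with vertex type `V` and hyperedges indexed by `E` (several hyperedges may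
have the same vertex set).  The hyperedge `e` carries a scale `c e` and a threshold `δ e ≥ 1`,
which determine its splitting function `A ↦ c e * min {|A|, |e \ A|, δ e}`. -/
structure CardHypergraph (V E : Type*) where
  /-- the set of vertices of a hyperedge -/
  verts : E → Finset V
  /-- the weight by which the gadget of a hyperedge is scaled -/
  c : E → ℝ
  /-- the threshold of the splitting function of a hyperedge -/
  δ : E → ℝ
  c_nonneg : ∀ e, 0 ≤ c e
  one_le_δ : ∀ e, 1 ≤ δ e

namespace CardHypergraph

noncomputable section

variable {V E : Type*} [Fintype V] [DecidableEq V] [Fintype E] [DecidableEq E]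

/-- The splitting function `f_e(A) = c_e * min {|A|, |e \ A|, δ_e}`. -/
def split (H : CardHypergraph V E) (e : E) (A : Finset V) : ℝ :=
  H.c e * min (min (A.card : ℝ) ((H.verts e \ A).card : ℝ)) (H.δ e)

/-- The hypergraph cut `cut(S) = ∑_e f_e(e ∩ S)`. -/
def cut (H : CardHypergraph V E) (S : Finset V) : ℝ :=
  ∑ e, H.split e (H.verts e ∩ S)

/-- The degree `d_v = ∑_{e ∋ v} f_e({v})`. -/
def deg (H : CardHypergraph V E) (v : V) : ℝ :=
  ∑ e with v ∈ H.verts e, H.split e {v}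

/-- The volume of a vertex set. -/
def vol (H : CardHypergraph V E) (S : Finset V) : ℝ :=
  ∑ v ∈ S, H.deg v

/-- The hypergraph conductance; it is meaningful when `S` and its complement have positive
volume. -/
def conductance (H : CardHypergraph V E) (S : Finset V) : ℝ :=
  H.cut S / min (H.vol S) (H.vol Sᶜ)

/-- `∂S`, the hyperedges which meet both `S` and its complement. -/
def boundary (H : CardHypergraph V E) (S : Finset V) : Finset E :=
  {e | (H.verts e ∩ S).Nonempty ∧ (H.verts e ∩ Sᶜ).Nonempty}

/-- `max_{e ∈ ∂S} min {δ_e, |e| / 2}` (equal to `0` if `∂S` is empty, where `cut(S) = 0`). -/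
def deltaBar (H : CardHypergraph V E) (S : Finset V) : ℝ :=
  ⨆ e : H.boundary S, min (H.δ e) (((H.verts e).card : ℝ) / 2)

/-- Nodes of the reduced directed graph: the vertices, an auxiliary node `a` and an
auxiliary node `b` for every hyperedge. -/
abbrev RedNode (V E : Type*) := V ⊕ (E ⊕ E)

/-- Weights of the reduced directed graph: for each hyperedge `e`, the edges `v → a_e` and
`b_e → v` of weight `c_e` for `v ∈ e`, and the edge `a_e → b_e` of weight `c_e δ_e`
(weight `0` means that there is no edge). -/
def redWeight (H : CardHypergraph V E) : RedNode V E → RedNode V E → ℝ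
  | .inl v, .inr (.inl e) => if v ∈ H.verts e then H.c e else 0
  | .inr (.inl e), .inr (.inr e') => if e = e' then H.c e * H.δ e else 0
  | .inr (.inr e), .inl v => if v ∈ H.verts e then H.c e else 0
  | _, _ => 0

/-- Nodes of the localized directed cut graph: those of the reduced graph, the source `s`
(`Sum.inr true`) and the sink `t` (`Sum.inr false`). -/
abbrev Node (V E : Type*) := RedNode V E ⊕ Bool

/-- Weights of the localized directed cut graph with seed set `R`: those of the reduced graph,
`s → r` of weight `γ d_r` for `r ∈ R`, and `v → t` of weight `γ d_v` for `v ∉ R`. -/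
def locWeight (H : CardHypergraph V E) (γ : ℝ) (R : Finset V) : Node V E → Node V E → ℝ
  | .inl i, .inl j => H.redWeight i j
  | .inr true, .inl (.inl r) => if r ∈ R then γ * H.deg r else 0
  | .inl (.inl v), .inr false => if v ∈ R then 0 else γ * H.deg v
  | _, _ => 0

/-- The objective `(1/2) wᵀ (B x)₊² + κ γ ∑_{v ∈ V} x_v d_v` of the local hypergraph quadratic
diffusion, the first sum being over the directed edges of the localized directed cut graph. -/
def objective (H : CardHypergraph V E) (γ κ : ℝ) (R : Finset V) (x : Node V E → ℝ) : ℝ :=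
  1 / 2 * ∑ i, ∑ j, H.locWeight γ R i j * (max (x i - x j) 0) ^ 2
    + κ * γ * ∑ v : V, x (.inl (.inl v)) * H.deg v

/-- The constraints `x_s = 1`, `x_t = 0`, `x ≥ 0`. -/
def Feasible (x : Node V E → ℝ) : Prop :=
  x (.inr true) = 1 ∧ x (.inr false) = 0 ∧ ∀ i, 0 ≤ x i

/-- `x` solves the local hypergraph quadratic diffusion problem with seed set `R`. -/
def IsDiffusion (H : CardHypergraph V E) (γ κ : ℝ) (R : Finset V) (x : Node V E → ℝ) : Prop :=
  Feasible x ∧ ∀ y : Node V E → ℝ, Feasible y → H.objective γ κ R x ≤ H.objective γ κ R y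

/-- The mass `∑_{u ∉ S} d_u x_u` outside `S`. -/
def massOutside (H : CardHypergraph V E) (S : Finset V) (x : Node V E → ℝ) : ℝ :=
  ∑ u ∈ Sᶜ, H.deg u * x (.inl (.inl u))

/-- `P` is a good sampling strategy with constant `c` for the target set `S`, where `x R` is the
solution of the diffusion problem with seed set `R`; seeds have positive degree. -/
def IsGoodSampling (H : CardHypergraph V E) (c : ℝ) (S : Finset V)
    (x : Finset V → Node V E → ℝ) (P : PMF V) : Prop :=
  (∀ v ∈ P.support, 0 < H.deg v) ∧
    ∑ v, (P v).toReal * (1 / H.deg v * H.massOutside S (x {v}))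
      ≤ c / H.vol S * H.massOutside S (x S)

/-- The set of the first `k` vertices in the order `σ`. -/
def prefixSet (σ : Fin (Fintype.card V) ≃ V) (k : ℕ) : Finset V :=
  {v | (σ.symm v : ℕ) < k}

/-- `T` is a result of the sweep cut over `x`: for some ordering of the vertices by decreasing
value of `x`, it has minimum conductance among the prefix sets.  Only prefix sets for which the
conductance is defined take part. -/
def IsSweepCut (H : CardHypergraph V E) (x : Node V E → ℝ) (T : Finset V) : Prop :=
  ∃ σ : Fin (Fintype.card V) ≃ V, Antitone (fun i => x (.inl (.inl (σ i)))) ∧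
    (∃ k, T = prefixSet σ k) ∧ 0 < H.vol T ∧ 0 < H.vol Tᶜ ∧
    ∀ k, 0 < H.vol (prefixSet σ k) → 0 < H.vol (prefixSet σ k)ᶜ →
      H.conductance T ≤ H.conductance (prefixSet σ k)

end

end CardHypergraph

/-! Call `∑ u ∈ T, d_u x_u` the mass of `T`. Two estimates meet: most seeds keep at least three
quarters of their mass in `S`, and a diffusion whose sweep prefixes all expand cannot do so.

Retention. Testing the problem seeded at `S` with the indicator of `S` bounds `γ` times its outside
mass by `cut S`. Good sampling and the bound on the conductance of `S` then make the expected
escaping fraction at most `1/8`, and Markov's inequality leaves at most `1/4` with probability at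
least `1/2`. A single-seed diffusion has total mass exactly `d_v`, so `3/4 * d_v` stays in `S`.

Expansion. Optimality makes `x` a potential of a conserved flow: every vertex drains `γ d_u x_u` and
the seed receives `γ d_v`. Hence the net gadget flow out of a threshold set `T` is at most `γ (d_v -
mass T)`. The combinatorial core, `exists_fracSelection_gadget`, shows that three times the net flow
through one gadget dominates the drop of `x` under a fractional exchange, across the threshold, of
total weight the splitting function. Summed over hyperedges (`IsDiffusion.exists_exchange`), this
moves weight `M = cut T` while respecting degrees. If `I(k)` is the largest mass of a fractional
vertex set of volume `k`, and `K = vol T`, a Lovász–Simonovits inequality follows: `2 I(K) - I(K -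
M) - I(K + M) ≤ 3 γ (d_v - I(K))`.

By a discrete maximum principle (`IsDiffusion.prefix_mass_le`), any concave `U` violating this
inequality in the right direction bounds `I`. If every prefix has conductance at least `ψ = √(32 γ
ln(100 vol S / d_v))`, a logarithmic barrier qualifies and has value below `3/4 * d_v` at `vol S`.
Thus some prefix has conductance below `ψ`; the factor `deltaBar` is at least `1` when the cut is
nonzero, so it only weakens the bound. -/

/-! ### Fractional selections and the flow through one gadget -/

/-- `α` is a fractional selection of total weight `C` from the finite set `A`. -/
structure IsFracSelection {ι : Type*} (A : Finset ι) (C : ℝ) (α : ι → ℝ) : Prop where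
  nonneg : ∀ i, 0 ≤ α i
  le_one : ∀ i, α i ≤ 1
  eq_zero : ∀ i, i ∉ A → α i = 0
  sum_eq : ∑ i ∈ A, α i = C

theorem IsFracSelection.le_weight {ι : Type*} {A : Finset ι} {C : ℝ} {α : ι → ℝ}
    (h : IsFracSelection A C α) (i : ι) : α i ≤ C := by
  by_cases hi : i ∈ A
  · rw [← h.sum_eq]
    exact Finset.single_le_sum (fun j _ => h.nonneg j) hi
  · rw [h.eq_zero i hi, ← h.sum_eq]
    exact Finset.sum_nonneg fun j _ => h.nonneg j

theorem isFracSelection_zero {ι : Type*} (A : Finset ι) : IsFracSelection A 0 0 :=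
  ⟨fun _ => le_rfl, fun _ => zero_le_one, fun _ _ => rfl, by simp⟩

theorem isFracSelection_uniform {ι : Type*} [DecidableEq ι] {A : Finset ι} {C : ℝ} (h0 : 0 < C)
    (hC : C ≤ A.card) : IsFracSelection A C (fun i => if i ∈ A then C / A.card else 0) := by
  have hA : (0 : ℝ) < A.card := h0.trans_le hC
  refine ⟨fun i => ?_, fun i => ?_, fun i hi => by simp [hi], ?_⟩
  · split_ifs
    · positivity
    · exact le_rfl
  · split_ifs
    · exact (div_le_one hA).2 hC
    · exact zero_le_one
  · rw [Finset.sum_congr rfl (fun i hi => if_pos hi), Finset.sum_const, nsmul_eq_mul]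
    field_simp

theorem exists_fracSelection {ι : Type*} [DecidableEq ι] {A : Finset ι} {C : ℝ} (h0 : 0 ≤ C)
    (hC : C ≤ A.card) : ∃ α : ι → ℝ, IsFracSelection A C α := by
  rcases h0.eq_or_lt with h | h
  · exact ⟨0, h ▸ isFracSelection_zero A⟩
  · exact ⟨_, isFracSelection_uniform h hC⟩

theorem IsFracSelection.sum_mul_le {ι : Type*} {A : Finset ι} {C : ℝ} {α : ι → ℝ}
    (h : IsFracSelection A C α) (x : ι → ℝ) (a : ℝ) :
    ∑ i ∈ A, α i * x i ≤ C * a + ∑ i ∈ A, max (x i - a) 0 := by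
  have : ∑ i ∈ A, α i * x i = C * a + ∑ i ∈ A, α i * (x i - a) := by
    rw [← h.sum_eq, Finset.sum_mul, ← Finset.sum_add_distrib]
    exact Finset.sum_congr rfl fun i _ => by ring
  rw [this]
  gcongr with i hi
  calc α i * (x i - a) ≤ α i * max (x i - a) 0 :=
        mul_le_mul_of_nonneg_left (le_max_left _ _) (h.nonneg i)
    _ ≤ max (x i - a) 0 := mul_le_of_le_one_left (le_max_right _ _) (h.le_one i)

theorem IsFracSelection.le_sum_mul {ι : Type*} {A : Finset ι} {C : ℝ} {α : ι → ℝ}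
    (h : IsFracSelection A C α) (x : ι → ℝ) (b : ℝ) :
    C * b - ∑ i ∈ A, max (b - x i) 0 ≤ ∑ i ∈ A, α i * x i := by
  have := h.sum_mul_le (fun i => - x i) (-b)
  simp only [mul_neg, Finset.sum_neg_distrib, neg_sub_neg] at this
  linarith

/-- Eliminating `G` gives `y ≤ Φ (C + p) / C²`, and `(C - p)(C + p) ≤ C²`. -/
theorem mul_le_of_mul_le_add {C p y Φ G : ℝ} (hC : 0 < C) (hp : 0 ≤ p) (hpC : p ≤ C) (hΦ : 0 ≤ Φ)
    (h1 : C * y ≤ Φ + G) (h2 : C * G ≤ p * Φ) : (C - p) * y ≤ Φ := by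
  refine le_of_mul_le_mul_left ?_ (mul_pos hC hC)
  calc C * C * ((C - p) * y) = (C - p) * (C * (C * y)) := by ring
    _ ≤ (C - p) * (C * (Φ + G)) :=
      mul_le_mul_of_nonneg_left (mul_le_mul_of_nonneg_left h1 hC.le) (by linarith)
    _ = (C - p) * (C * Φ + C * G) := by ring
    _ ≤ (C - p) * (C * Φ + p * Φ) := mul_le_mul_of_nonneg_left (by linarith) (by linarith)
    _ = C * C * Φ - p * p * Φ := by ring
    _ ≤ C * C * Φ := by linarith [mul_nonneg (mul_nonneg hp hp) hΦ]

/-- A selection of weight `C` from `B` favouring the large values of `x`, when the threshold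
separating `A` from `B` is at least the potential `a` of the first auxiliary node. -/
theorem exists_fracSelection_of_le_threshold {ι : Type*} [DecidableEq ι] (A B : Finset ι)
    (x : ι → ℝ) {a b δ C τ : ℝ} (hC0 : 0 < C) (hCA : C ≤ A.card) (hCB : C ≤ B.card) (hCδ : C ≤ δ)
    (hA : ∀ u ∈ A, τ ≤ x u) (hB : ∀ w ∈ B, x w ≤ τ) (hab : b ≤ a) (haτ : a ≤ τ)
    (h1 : ∑ u ∈ A, max (x u - a) 0 + ∑ u ∈ B, max (x u - a) 0 = δ * (a - b))
    (h2 : ∑ u ∈ A, max (b - x u) 0 + ∑ u ∈ B, max (b - x u) 0 = δ * (a - b)) :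
    ∃ β : ι → ℝ, IsFracSelection B C β ∧
      C * a - 2 * ∑ u ∈ A, max (x u - a) 0 ≤ ∑ w ∈ B, β w * x w := by
  set Φ := ∑ u ∈ A, max (x u - a) 0 with hΦ
  have hΦC : C * (τ - a) ≤ Φ := by
    calc C * (τ - a) ≤ A.card * (τ - a) := by gcongr
      _ = ∑ u ∈ A, (τ - a) := by rw [Finset.sum_const, nsmul_eq_mul]
      _ ≤ Φ := Finset.sum_le_sum fun u hu => le_max_of_le_left (by linarith [hA u hu])
  have hΦ0 : 0 ≤ Φ := Finset.sum_nonneg fun _ _ => le_max_right _ _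
  have hA0 : ∑ u ∈ A, max (b - x u) 0 = 0 :=
    Finset.sum_eq_zero fun u hu => max_eq_right (by linarith [hA u hu])
  set P := B.filter (fun w => a < x w) with hP
  set N := B.filter (fun w => ¬ a < x w) with hN
  have hsplit : ∀ f : ι → ℝ, ∑ w ∈ P, f w + ∑ w ∈ N, f w = ∑ w ∈ B, f w := fun f =>
    Finset.sum_filter_add_sum_filter_not B _ f
  have hcard : (P.card : ℝ) + N.card = B.card := by
    have := hsplit (fun _ => 1)
    simpa using this
  have hPB : P ⊆ B := Finset.filter_subset _ _
  -- If the part `P` of `B` above `a` can carry all the weight, the average is already at least `a`.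
  -- Otherwise `P` is taken entirely and the remaining `C - p` is spread evenly over `N`.
  by_cases hpC : C ≤ P.card
  · refine ⟨_, ⟨(isFracSelection_uniform hC0 hpC).nonneg, (isFracSelection_uniform hC0 hpC).le_one,
      fun i hi => if_neg fun h => hi (hPB h), ?_⟩, ?_⟩
    · exact (Finset.sum_subset hPB fun i _ hi => if_neg hi).symm.trans
        (isFracSelection_uniform hC0 hpC).sum_eq
    · rw [← Finset.sum_subset hPB (fun i _ hi => by simp [hi])]
      have := (isFracSelection_uniform hC0 hpC).le_sum_mul x a
      have h0 : ∑ i ∈ P, max (a - x i) 0 = 0 := Finset.sum_eq_zero fun i hi =>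
        max_eq_right (by linarith [(Finset.mem_filter.1 hi).2])
      linarith
  · push Not at hpC
    set p : ℝ := (P.card : ℝ) with hp
    have hp0 : 0 ≤ p := Nat.cast_nonneg _
    have hNpos : (0 : ℝ) < N.card := by linarith
    have hN_of : ∀ w, w ∈ N → ¬ a < x w := fun w hw => (Finset.mem_filter.1 hw).2
    have hP_of : ∀ w, w ∈ P → a < x w := fun w hw => (Finset.mem_filter.1 hw).2
    set θ : ℝ := (C - p) / N.card with hθ
    have hθ0 : 0 ≤ θ := div_nonneg (by linarith) hNpos.le
    have hθ1 : θ ≤ 1 := (div_le_one hNpos).2 (by linarith)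
    have hθN : N.card * θ = C - p := by rw [hθ]; field_simp
    set β : ι → ℝ := fun w => if w ∈ B then (if a < x w then 1 else θ) else 0 with hβ
    have hβP : ∀ w ∈ P, β w = 1 := fun w hw => by simp [hβ, hPB hw, hP_of w hw]
    have hβN : ∀ w ∈ N, β w = θ := fun w hw => by
      simp only [hβ, (Finset.mem_filter.1 hw).1, if_true, hN_of w hw, if_false]
    refine ⟨β, ⟨fun i => ?_, fun i => ?_, fun i hi => if_neg hi, ?_⟩, ?_⟩
    · simp only [hβ]; split_ifs <;> linarith
    · simp only [hβ]; split_ifs <;> linarith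
    · rw [← hsplit, Finset.sum_congr rfl hβP, Finset.sum_congr rfl hβN]
      simp only [Finset.sum_const, nsmul_eq_mul, mul_one]
      linarith
    · set G := ∑ w ∈ P, (x w - a) with hG
      have hGF : Φ + G = δ * (a - b) := by
        rw [← h1, ← hsplit]
        have e1 : ∑ w ∈ P, max (x w - a) 0 = G :=
          Finset.sum_congr rfl fun w hw => max_eq_left (by linarith [hP_of w hw])
        have e2 : ∑ w ∈ N, max (x w - a) 0 = 0 :=
          Finset.sum_eq_zero fun w hw => max_eq_right (by linarith [hN_of w hw])
        rw [e1, e2]; ring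
      have hbF : ∑ w ∈ N, max (b - x w) 0 = δ * (a - b) := by
        rw [← h2, ← hsplit, hA0]
        have e1 : ∑ w ∈ P, max (b - x w) 0 = 0 :=
          Finset.sum_eq_zero fun w hw => max_eq_right (by linarith [hP_of w hw])
        rw [e1]; ring
      have hGp : G ≤ p * (τ - a) := by
        rw [hp, ← nsmul_eq_mul]
        exact Finset.sum_le_card_nsmul _ _ _ fun w hw => by linarith [hB w (hPB hw)]
      have hNs : ∑ w ∈ N, (a - x w) ≤ N.card * (a - b) + δ * (a - b) := by
        rw [← hbF, ← nsmul_eq_mul, ← Finset.sum_const, ← Finset.sum_add_distrib]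
        exact Finset.sum_le_sum fun w _ => by linarith [le_max_left (b - x w) 0]
      have hsum : ∑ w ∈ B, β w * x w = C * a + G - θ * ∑ w ∈ N, (a - x w) := by
        have e1 : ∑ w ∈ P, β w * x w = ∑ w ∈ P, x w :=
          Finset.sum_congr rfl fun w hw => by rw [hβP w hw, one_mul]
        have e2 : ∑ w ∈ N, β w * x w = θ * ∑ w ∈ N, x w := by
          rw [Finset.mul_sum]
          exact Finset.sum_congr rfl fun w hw => by rw [hβN w hw]
        rw [← hsplit, e1, e2, hG, Finset.sum_sub_distrib, Finset.sum_sub_distrib,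
          Finset.sum_const, Finset.sum_const, nsmul_eq_mul, nsmul_eq_mul]
        linear_combination (a : ℝ) * hθN
      have hF0 : 0 ≤ δ * (a - b) := mul_nonneg (by linarith) (by linarith)
      have hθs : θ * ∑ w ∈ N, (a - x w) ≤ (C - p) * (a - b) + δ * (a - b) := by
        calc θ * ∑ w ∈ N, (a - x w) ≤ θ * (N.card * (a - b) + δ * (a - b)) := by gcongr
          _ = (C - p) * (a - b) + θ * (δ * (a - b)) := by rw [← hθN]; ring
          _ ≤ (C - p) * (a - b) + δ * (a - b) := by
            linarith [mul_le_of_le_one_left hF0 hθ1]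
      have hCab : C * (a - b) ≤ Φ + G := by
        rw [hGF]; exact mul_le_mul_of_nonneg_right hCδ (by linarith)
      have hCG : C * G ≤ p * Φ := by
        calc C * G ≤ C * (p * (τ - a)) := by gcongr
          _ = p * (C * (τ - a)) := by ring
          _ ≤ p * Φ := by gcongr
      -- The selection loses at most `(C - p)(a - b) + δ(a - b)` below level `a` and gains `G`.
      -- Since `δ(a - b) = Φ + G`, the gain cancels and one `Φ` is lost; `key` pays for the other
      -- term with a second `Φ`.
      have key : (C - p) * (a - b) ≤ Φ :=
        mul_le_of_mul_le_add hC0 hp0 hpC.le hΦ0 hCab hCG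
      rw [hsum]
      linarith

/-- The flow through the gadget of a hyperedge across a threshold set: `A` is the part above the
threshold `τ`, `B` the part below it, and `a`, `b` are the potentials of the auxiliary nodes. -/
theorem exists_fracSelection_gadget {ι : Type*} [DecidableEq ι] (A B : Finset ι)
    (x : ι → ℝ) {a b δ τ : ℝ} (hδ : 1 ≤ δ)
    (hA : ∀ u ∈ A, τ ≤ x u) (hB : ∀ w ∈ B, x w ≤ τ)
    (h1 : ∑ u ∈ A, max (x u - a) 0 + ∑ u ∈ B, max (x u - a) 0 = δ * max (a - b) 0)
    (h2 : ∑ u ∈ A, max (b - x u) 0 + ∑ u ∈ B, max (b - x u) 0 = δ * max (a - b) 0) :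
    ∃ α β : ι → ℝ, IsFracSelection A (min (min (A.card : ℝ) B.card) δ) α ∧
      IsFracSelection B (min (min (A.card : ℝ) B.card) δ) β ∧
      ∑ u ∈ A, α u * x u - ∑ w ∈ B, β w * x w ≤
        3 * (∑ u ∈ A, max (x u - a) 0 - ∑ u ∈ A, max (b - x u) 0) := by
  by_cases hAe : A = ∅
  · subst hAe
    have : min (min (((∅ : Finset ι).card : ℝ)) B.card) δ = 0 := by
      simp [zero_le_one.trans hδ]
    rw [this]
    exact ⟨0, 0, isFracSelection_zero _, isFracSelection_zero _, by simp⟩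
  by_cases hBe : B = ∅
  · subst hBe
    have : min (min (A.card : ℝ) ((∅ : Finset ι).card : ℝ)) δ = 0 := by
      simp [zero_le_one.trans hδ]
    rw [this]
    refine ⟨0, 0, isFracSelection_zero _, isFracSelection_zero _, ?_⟩
    simp only [Finset.sum_empty, add_zero] at h1 h2
    simp [h1, h2]
  have hAc : (0 : ℝ) < A.card := by exact_mod_cast Finset.card_pos.2 (Finset.nonempty_of_ne_empty hAe)
  have hBc : (0 : ℝ) < B.card := by exact_mod_cast Finset.card_pos.2 (Finset.nonempty_of_ne_empty hBe)
  set C := min (min (A.card : ℝ) B.card) δ with hC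
  have hC0 : 0 < C := lt_min (lt_min hAc hBc) (by linarith)
  have hCA : C ≤ A.card := (min_le_left _ _).trans (min_le_left _ _)
  have hCB : C ≤ B.card := (min_le_left _ _).trans (min_le_right _ _)
  have hCδ : C ≤ δ := min_le_right _ _
  -- If `a < b`, no flow passes, so every `x u` would be at most `a` and at least `b`.
  have hab : b ≤ a := by
    by_contra! hlt
    rw [max_eq_right (by linarith), mul_zero] at h1 h2
    obtain ⟨u, hu⟩ := Finset.nonempty_of_ne_empty hAe
    have n1 : ∀ (D : Finset ι) (f : ι → ℝ), 0 ≤ ∑ i ∈ D, max (f i) 0 := fun D f =>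
      Finset.sum_nonneg fun _ _ => le_max_right _ _
    have s1 : max (x u - a) 0 ≤ ∑ i ∈ A, max (x i - a) 0 :=
      Finset.single_le_sum (f := fun i => max (x i - a) 0) (fun _ _ => le_max_right _ _) hu
    have s2 : max (b - x u) 0 ≤ ∑ i ∈ A, max (b - x i) 0 :=
      Finset.single_le_sum (f := fun i => max (b - x i) 0) (fun _ _ => le_max_right _ _) hu
    have := n1 B (fun i => x i - a)
    have := n1 B (fun i => b - x i)
    linarith [le_max_left (x u - a) 0, le_max_left (b - x u) 0]
  rw [max_eq_left (by linarith)] at h1 h2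
  have uA := isFracSelection_uniform hC0 hCA
  have uB := isFracSelection_uniform hC0 hCB
  rcases le_total a τ with haτ | haτ
  · obtain ⟨β, hβ, hβx⟩ := exists_fracSelection_of_le_threshold A B x hC0 hCA hCB hCδ hA hB hab haτ
      h1 h2
    refine ⟨_, β, uA, hβ, ?_⟩
    have hA0 : ∑ u ∈ A, max (b - x u) 0 = 0 :=
      Finset.sum_eq_zero fun u hu => max_eq_right (by linarith [hA u hu])
    linarith [uA.sum_mul_le x a]
  rcases le_total τ b with hτb | hτb
  -- Reversing all edges and negating potentials swaps `A` with `B` and `a` with `-b`, reducing to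
  -- the previous case.
  · obtain ⟨α, hα, hαx⟩ := exists_fracSelection_of_le_threshold B A (fun i => - x i)
      (a := -b) (b := -a) (τ := -τ) hC0 hCB hCA hCδ (fun u hu => by linarith [hB u hu])
      (fun u hu => by linarith [hA u hu]) (by linarith) (by linarith)
      (by simp only [neg_sub_neg]; linarith) (by simp only [neg_sub_neg]; linarith)
    simp only [neg_sub_neg, mul_neg, Finset.sum_neg_distrib] at hαx
    refine ⟨α, _, hα, uB, ?_⟩
    have hB0 : ∑ u ∈ B, max (x u - a) 0 = 0 :=
      Finset.sum_eq_zero fun u hu => max_eq_right (by linarith [hB u hu])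
    linarith [uB.le_sum_mul x b]
  -- With `b ≤ τ ≤ a` all flow goes from `A` to `B`, and its value `δ(a - b)` bounds each of three
  -- terms: the excess above `a`, the deficit below `b`, and `C(a - b)`.
  · refine ⟨_, _, uA, uB, ?_⟩
    have hA0 : ∑ u ∈ A, max (b - x u) 0 = 0 :=
      Finset.sum_eq_zero fun u hu => max_eq_right (by linarith [hA u hu])
    have hB0 : ∑ u ∈ B, max (x u - a) 0 = 0 :=
      Finset.sum_eq_zero fun u hu => max_eq_right (by linarith [hB u hu])
    have : C * (a - b) ≤ δ * (a - b) := mul_le_mul_of_nonneg_right hCδ (by linarith)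
    linarith [uA.sum_mul_le x a, uB.le_sum_mul x b]

/-! ### First variation of the energy and conservation of flow -/

namespace CardHypergraph

noncomputable section

set_option linter.unusedSectionVars false

variable {V E : Type*} [Fintype V] [DecidableEq V] [Fintype E] [DecidableEq E]

theorem split_nonneg (H : CardHypergraph V E) (e : E) (A : Finset V) : 0 ≤ H.split e A :=
  mul_nonneg (H.c_nonneg e) (le_min (le_min (Nat.cast_nonneg _) (Nat.cast_nonneg _))
    (zero_le_one.trans (H.one_le_δ e)))

theorem deg_nonneg (H : CardHypergraph V E) (v : V) : 0 ≤ H.deg v :=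
  Finset.sum_nonneg fun e _ => H.split_nonneg e _

theorem cut_nonneg (H : CardHypergraph V E) (S : Finset V) : 0 ≤ H.cut S :=
  Finset.sum_nonneg fun e _ => H.split_nonneg e _

theorem vol_nonneg (H : CardHypergraph V E) (S : Finset V) : 0 ≤ H.vol S :=
  Finset.sum_nonneg fun v _ => H.deg_nonneg v

theorem vol_add_vol_compl (H : CardHypergraph V E) (S : Finset V) :
    H.vol S + H.vol Sᶜ = H.vol Finset.univ :=
  Finset.sum_add_sum_compl S _

theorem deg_le_vol (H : CardHypergraph V E) {S : Finset V} {v : V} (hv : v ∈ S) :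
    H.deg v ≤ H.vol S :=
  Finset.single_le_sum (fun u _ => H.deg_nonneg u) hv

theorem locWeight_nonneg (H : CardHypergraph V E) {γ : ℝ} (hγ : 0 ≤ γ) (R : Finset V)
    (i j : Node V E) : 0 ≤ H.locWeight γ R i j := by
  have hδ := fun e => mul_nonneg (H.c_nonneg e) (zero_le_one.trans (H.one_le_δ e))
  unfold locWeight redWeight
  split <;> (try split) <;> (try split_ifs) <;>
    first
      | exact le_rfl
      | exact hδ _
      | exact H.c_nonneg _
      | exact mul_nonneg hγ (H.deg_nonneg _)

/-- A sum over the edges of the localized directed cut graph. -/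
theorem sum_locWeight_mul (H : CardHypergraph V E) (γ : ℝ) (R : Finset V)
    (g : Node V E → Node V E → ℝ) :
    ∑ i, ∑ j, H.locWeight γ R i j * g i j =
      ∑ e, H.c e * (∑ v ∈ H.verts e, g (.inl (.inl v)) (.inl (.inr (.inl e)))
          + H.δ e * g (.inl (.inr (.inl e))) (.inl (.inr (.inr e)))
          + ∑ v ∈ H.verts e, g (.inl (.inr (.inr e))) (.inl (.inl v)))
        + ∑ r ∈ R, γ * H.deg r * g (.inr true) (.inl (.inl r))
        + ∑ v ∈ Rᶜ, γ * H.deg v * g (.inl (.inl v)) (.inr false) := by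
  have h1 : ∀ e, ∑ v ∈ H.verts e, g (.inl (.inl v)) (.inl (.inr (.inl e))) =
      ∑ v, if v ∈ H.verts e then g (.inl (.inl v)) (.inl (.inr (.inl e))) else 0 := fun e => by
    rw [← Finset.sum_filter]; simp
  have h2 : ∀ e, ∑ v ∈ H.verts e, g (.inl (.inr (.inr e))) (.inl (.inl v)) =
      ∑ v, if v ∈ H.verts e then g (.inl (.inr (.inr e))) (.inl (.inl v)) else 0 := fun e => by
    rw [← Finset.sum_filter]; simp
  have h3 : ∑ r ∈ R, γ * H.deg r * g (.inr true) (.inl (.inl r)) =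
      ∑ r, if r ∈ R then γ * H.deg r * g (.inr true) (.inl (.inl r)) else 0 := by
    rw [← Finset.sum_filter]; simp
  have h4 : ∑ v ∈ Rᶜ, γ * H.deg v * g (.inl (.inl v)) (.inr false) =
      ∑ v, if v ∈ R then 0 else γ * H.deg v * g (.inl (.inl v)) (.inr false) := by
    rw [← Finset.sum_filter_add_sum_filter_not Finset.univ (· ∈ R)]
    rw [Finset.sum_ite_of_true (by simp), Finset.sum_ite_of_false (by simp)]
    simp only [Finset.sum_const_zero, zero_add]
    exact Finset.sum_congr (by ext; simp) fun _ _ => rfl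
  simp only [h1, h2, h3, h4]
  simp only [Fintype.sum_sum_type, Fintype.sum_bool, locWeight, redWeight, zero_mul,
    Finset.sum_const_zero, add_zero, zero_add, ite_mul, Finset.sum_add_distrib, mul_add,
    Finset.sum_ite_eq, Finset.mem_univ, if_true, Finset.mul_sum, mul_ite, mul_zero]
  rw [Finset.sum_comm (s := (Finset.univ : Finset V)) (t := (Finset.univ : Finset E))]
  simp only [mul_assoc]
  ring

/-- The first variation at `x` of the energy of the localized directed cut graph. -/
def flowForm (H : CardHypergraph V E) (γ : ℝ) (R : Finset V) (x z : Node V E → ℝ) : ℝ :=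
  ∑ i, ∑ j, H.locWeight γ R i j * (max (x i - x j) 0 * (z i - z j))

theorem flowForm_add (H : CardHypergraph V E) (γ : ℝ) (R : Finset V) (x z z' : Node V E → ℝ) :
    H.flowForm γ R x (z + z') = H.flowForm γ R x z + H.flowForm γ R x z' := by
  simp only [flowForm, ← Finset.sum_add_distrib, Pi.add_apply]
  exact Finset.sum_congr rfl fun i _ => Finset.sum_congr rfl fun j _ => by ring

theorem flowForm_smul (H : CardHypergraph V E) (γ : ℝ) (R : Finset V) (x z : Node V E → ℝ)
    (t : ℝ) : H.flowForm γ R x (t • z) = t * H.flowForm γ R x z := by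
  simp only [flowForm, Finset.mul_sum, Pi.smul_apply, smul_eq_mul]
  exact Finset.sum_congr rfl fun i _ => Finset.sum_congr rfl fun j _ => by ring

theorem flowForm_sum (H : CardHypergraph V E) (γ : ℝ) (R : Finset V) (x : Node V E → ℝ)
    {ι : Type*} (s : Finset ι) (z : ι → Node V E → ℝ) :
    H.flowForm γ R x (∑ k ∈ s, z k) = ∑ k ∈ s, H.flowForm γ R x (z k) := by
  classical
  induction s using Finset.induction_on with
  | empty => simp [flowForm]
  | insert a s ha ih => rw [Finset.sum_insert ha, Finset.sum_insert ha, flowForm_add, ih]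

/-- The squared positive part has a derivative with Lipschitz constant `2`; this quadratic upper
bound replaces differentiation of the objective. -/
theorem max_add_sq_le (p q : ℝ) : max (p + q) 0 ^ 2 ≤ max p 0 ^ 2 + 2 * (max p 0 * q) + q ^ 2 := by
  rcases max_cases (p + q) 0 with ⟨h, h'⟩ | ⟨h, h'⟩ <;>
  rcases max_cases p 0 with ⟨k, k'⟩ | ⟨k, k'⟩ <;> rw [h, k] <;> nlinarith [sq_nonneg (p + q)]

theorem objective_add_le (H : CardHypergraph V E) {γ : ℝ} (hγ : 0 ≤ γ) (R : Finset V)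
    (x z : Node V E → ℝ) :
    H.objective γ 0 R (x + z) ≤ H.objective γ 0 R x + H.flowForm γ R x z
      + 1 / 2 * ∑ i, ∑ j, H.locWeight γ R i j * (z i - z j) ^ 2 := by
  have : ∑ i, ∑ j, H.locWeight γ R i j * max ((x + z) i - (x + z) j) 0 ^ 2 ≤
      ∑ i, ∑ j, H.locWeight γ R i j * max (x i - x j) 0 ^ 2 + 2 * H.flowForm γ R x z
      + ∑ i, ∑ j, H.locWeight γ R i j * (z i - z j) ^ 2 := by
    simp only [flowForm, Finset.mul_sum, ← Finset.sum_add_distrib]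
    gcongr with i _ j _
    have h := mul_le_mul_of_nonneg_left (max_add_sq_le (x i - x j) (z i - z j))
      (H.locWeight_nonneg hγ R i j)
    have e : (x + z) i - (x + z) j = x i - x j + (z i - z j) := by simp only [Pi.add_apply]; ring
    rw [e]
    linarith
  simp only [objective]
  linarith

theorem IsDiffusion.flowForm_nonneg {H : CardHypergraph V E} {γ : ℝ} (hγ : 0 ≤ γ)
    {R : Finset V} {x : Node V E → ℝ} (hx : H.IsDiffusion γ 0 R x) {z : Node V E → ℝ} {ε : ℝ}
    (hε : 0 < ε) (hz : ∀ h, 0 < h → h ≤ ε → Feasible (x + h • z)) :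
    0 ≤ H.flowForm γ R x z := by
  by_contra! hneg
  set Q := ∑ i, ∑ j, H.locWeight γ R i j * (z i - z j) ^ 2 with hQ
  have hQ0 : 0 ≤ Q := Finset.sum_nonneg fun i _ => Finset.sum_nonneg fun j _ =>
    mul_nonneg (H.locWeight_nonneg hγ R i j) (sq_nonneg _)
  set D := H.flowForm γ R x z
  -- A step short enough that the quadratic error `h² Q / 2` cannot offset the decrease `h D`; the
  -- `+ 1` covers `Q = 0`.
  set h := min ε (-D / (Q + 1)) with hh
  have hh0 : 0 < h := lt_min hε (div_pos (by linarith) (by linarith))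
  have hhQ : h * (Q + 1) ≤ -D := by
    rw [← le_div_iff₀ (by linarith)]
    exact min_le_right _ _
  have h1 := hx.2 _ (hz h hh0 (min_le_left _ _))
  have h2 := H.objective_add_le hγ R x (h • z)
  have h3 : ∑ i, ∑ j, H.locWeight γ R i j * ((h • z) i - (h • z) j) ^ 2 = h ^ 2 * Q := by
    rw [hQ]
    simp only [Finset.mul_sum, Pi.smul_apply, smul_eq_mul]
    exact Finset.sum_congr rfl fun i _ => Finset.sum_congr rfl fun j _ => by ring
  rw [h3, flowForm_smul] at h2
  have h4 : 0 ≤ h * D + 1 / 2 * (h ^ 2 * Q) := by linarith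
  nlinarith

theorem IsDiffusion.flowForm_single {H : CardHypergraph V E} {γ : ℝ} (hγ : 0 ≤ γ)
    {R : Finset V} {x : Node V E → ℝ} (hx : H.IsDiffusion γ 0 R x) (i : RedNode V E) :
    H.flowForm γ R x (Pi.single (.inl i) 1) = 0 := by
  obtain ⟨hs, ht, h0⟩ := hx.1
  have hfeas : ∀ h : ℝ, 0 ≤ x (.inl i) + h →
      Feasible (x + h • (Pi.single (.inl i) 1 : Node V E → ℝ)) := fun h hh => by
    refine ⟨by simp [hs], by simp [ht], fun j => ?_⟩
    by_cases hj : j = .inl i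
    · subst hj; simpa using hh
    · simpa [hj] using h0 j
  refine le_antisymm ?_ (hx.flowForm_nonneg hγ one_pos fun h hh _ =>
    hfeas h (add_nonneg (h0 _) hh.le))
  -- When the constraint `x ≥ 0` is active only increases are admissible. The reverse sign holds
  -- termwise: a node at potential `0` sends nothing out, and inflow contributes negatively. When it
  -- is inactive, a decrease is also admissible.
  rcases (h0 (.inl i)).eq_or_lt with hi | hi
  · refine Finset.sum_nonpos fun k _ => Finset.sum_nonpos fun j _ =>
      mul_nonpos_of_nonneg_of_nonpos (H.locWeight_nonneg hγ R k j) ?_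
    by_cases hk : k = .inl i
    · subst hk
      rw [max_eq_right (by linarith [h0 j]), zero_mul]
    · refine mul_nonpos_of_nonneg_of_nonpos (le_max_right _ _) ?_
      rw [Pi.single_eq_of_ne hk, zero_sub, neg_nonpos]
      by_cases hj : j = .inl i
      · subst hj; simp
      · rw [Pi.single_eq_of_ne hj]
  · have := hx.flowForm_nonneg hγ (z := (-1 : ℝ) • Pi.single (.inl i) 1) hi fun h hh hle => by
      rw [smul_smul]
      exact hfeas _ (by linarith)
    rw [flowForm_smul] at this
    linarith

/-- Conservation of flow at a solution of the diffusion problem. -/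
theorem IsDiffusion.flowForm_eq {H : CardHypergraph V E} {γ : ℝ} (hγ : 0 ≤ γ)
    {R : Finset V} {x : Node V E → ℝ} (hx : H.IsDiffusion γ 0 R x) (z : Node V E → ℝ) :
    H.flowForm γ R x z = (z (.inr true) - z (.inr false)) * (γ * H.massOutside R x) := by
  have hlin : ∀ z : Node V E → ℝ, H.flowForm γ R x z =
      z (.inr true) * H.flowForm γ R x (Pi.single (.inr true) 1)
      + z (.inr false) * H.flowForm γ R x (Pi.single (.inr false) 1) := fun z => by
    have hz : z = ∑ i, z i • (Pi.single i 1 : Node V E → ℝ) := by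
      ext j; simp [Finset.sum_apply, Pi.single_apply]
    conv_lhs => rw [hz]
    rw [flowForm_sum]
    simp only [flowForm_smul]
    rw [Fintype.sum_sum_type, Fintype.sum_bool]
    simp [hx.flowForm_single hγ]
  -- Constants have zero variation, so the source and sink coefficients are opposite; the sink one
  -- is read off from its incoming edges.
  have hone : H.flowForm γ R x 1 = 0 := by simp [flowForm]
  have ht : H.flowForm γ R x (Pi.single (.inr false) 1) = - (γ * H.massOutside R x) := by
    rw [flowForm, sum_locWeight_mul]
    have h0 := hx.1.2.2
    simp [hx.1.2.1, massOutside, Finset.mul_sum, h0, mul_assoc]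
  have h1 := hlin 1
  rw [hone, ht] at h1
  rw [hlin z, ht]
  simp only [Pi.one_apply, one_mul] at h1
  linear_combination (- z (.inr true)) * h1

theorem flowForm_self (H : CardHypergraph V E) (γ : ℝ) (R : Finset V) (x : Node V E → ℝ) :
    H.flowForm γ R x x = 2 * H.objective γ 0 R x := by
  have : ∀ p : ℝ, max p 0 * p = max p 0 ^ 2 := fun p => by
    rcases max_cases p 0 with ⟨h, _⟩ | ⟨h, _⟩ <;> rw [h] <;> ring
  simp only [flowForm, objective, this]
  ring

theorem sum_flow_eq {H : CardHypergraph V E} {γ : ℝ} (hγ : 0 ≤ γ) {R : Finset V}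
    {x : Node V E → ℝ} (hx : H.IsDiffusion γ 0 R x) (z : Node V E → ℝ) :
    ∑ e, H.c e * (∑ v ∈ H.verts e, max (x (.inl (.inl v)) - x (.inl (.inr (.inl e)))) 0 *
              (z (.inl (.inl v)) - z (.inl (.inr (.inl e))))
          + H.δ e * (max (x (.inl (.inr (.inl e))) - x (.inl (.inr (.inr e)))) 0 *
              (z (.inl (.inr (.inl e))) - z (.inl (.inr (.inr e)))))
          + ∑ v ∈ H.verts e, max (x (.inl (.inr (.inr e))) - x (.inl (.inl v))) 0 *
              (z (.inl (.inr (.inr e))) - z (.inl (.inl v))))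
        + ∑ r ∈ R, γ * H.deg r *
            (max (1 - x (.inl (.inl r))) 0 * (z (.inr true) - z (.inl (.inl r))))
        + ∑ v ∈ Rᶜ, γ * H.deg v *
            (x (.inl (.inl v)) * (z (.inl (.inl v)) - z (.inr false))) =
      (z (.inr true) - z (.inr false)) * (γ * H.massOutside R x) := by
  rw [← hx.flowForm_eq hγ z, flowForm, sum_locWeight_mul]
  simp [hx.1.1, hx.1.2.1, hx.1.2.2]

/-- At a solution, the gadget of each hyperedge transports all the flow it receives. -/
theorem IsDiffusion.gadget_in {H : CardHypergraph V E} {γ : ℝ} (hγ : 0 ≤ γ) {R : Finset V}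
    {x : Node V E → ℝ} (hx : H.IsDiffusion γ 0 R x) (e : E) (he : H.c e ≠ 0) :
    ∑ v ∈ H.verts e, max (x (.inl (.inl v)) - x (.inl (.inr (.inl e)))) 0 =
      H.δ e * max (x (.inl (.inr (.inl e))) - x (.inl (.inr (.inr e)))) 0 := by
  have := sum_flow_eq hγ hx (Sum.elim (Sum.elim 0 (Sum.elim (Pi.single e 1) 0)) 0)
  simp only [Sum.elim_inl, Sum.elim_inr, Pi.zero_apply, sub_zero, zero_sub, mul_neg,
    Finset.sum_neg_distrib, ← Finset.sum_mul, mul_zero, Finset.sum_const_zero, add_zero,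
    zero_mul, Pi.single_apply] at this
  rw [Finset.sum_eq_single e (fun e' _ h => by simp [h]) (by simp)] at this
  simp only [if_true, mul_one, mul_eq_zero, he, false_or] at this
  linarith

theorem IsDiffusion.gadget_out {H : CardHypergraph V E} {γ : ℝ} (hγ : 0 ≤ γ) {R : Finset V}
    {x : Node V E → ℝ} (hx : H.IsDiffusion γ 0 R x) (e : E) (he : H.c e ≠ 0) :
    ∑ v ∈ H.verts e, max (x (.inl (.inr (.inr e))) - x (.inl (.inl v))) 0 =
      H.δ e * max (x (.inl (.inr (.inl e))) - x (.inl (.inr (.inr e)))) 0 := by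
  have := sum_flow_eq hγ hx (Sum.elim (Sum.elim 0 (Sum.elim 0 (Pi.single e 1))) 0)
  simp only [Sum.elim_inl, Sum.elim_inr, Pi.zero_apply, sub_zero, zero_sub, mul_neg,
    ← Finset.sum_mul, mul_zero, Finset.sum_const_zero, add_zero,
    zero_mul, Pi.single_apply, zero_add] at this
  rw [Finset.sum_eq_single e (fun e' _ h => by simp [h]) (by simp)] at this
  simp only [if_true, mul_one, mul_eq_zero, he, false_or] at this
  linarith

/-! ### Leakage, mass balance and the maximum principle -/

/-- The auxiliary potentials `(0, 0)`, `(1, 1)`, `(1, 0)` cost exactly the three terms of the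
minimum: cutting the edges into `a_e`, those out of `b_e`, or the middle edge. -/
theorem exists_gadget_energy_le (A S : Finset V) (δ : ℝ) :
    ∃ p q : ℝ, 0 ≤ p ∧ 0 ≤ q ∧
      ∑ v ∈ A, max ((if v ∈ S then 1 else 0) - p) 0 ^ 2 + δ * max (p - q) 0 ^ 2
        + ∑ v ∈ A, max (q - (if v ∈ S then 1 else 0)) 0 ^ 2 ≤
      min (min ((A ∩ S).card : ℝ) ((A \ (A ∩ S)).card : ℝ)) δ := by
  have h10 : ∑ v ∈ A, max ((if v ∈ S then (1 : ℝ) else 0) - 1) 0 ^ 2 = 0 :=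
    Finset.sum_eq_zero fun v _ => by split_ifs <;> simp
  have h00 : ∑ v ∈ A, max (0 - (if v ∈ S then (1 : ℝ) else 0)) 0 ^ 2 = 0 :=
    Finset.sum_eq_zero fun v _ => by split_ifs <;> simp
  have h0 : ∑ v ∈ A, max ((if v ∈ S then (1 : ℝ) else 0) - 0) 0 ^ 2 = (A ∩ S).card := by
    rw [← Finset.filter_mem_eq_inter, Finset.card_filter]
    push_cast
    exact Finset.sum_congr rfl fun v _ => by split_ifs <;> simp
  have h1 : ∑ v ∈ A, max (1 - (if v ∈ S then (1 : ℝ) else 0)) 0 ^ 2 =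
      (A \ (A ∩ S)).card := by
    rw [Finset.sdiff_inter_self_left, Finset.sdiff_eq_filter, Finset.card_filter]
    push_cast
    exact Finset.sum_congr rfl fun v _ => by by_cases h : v ∈ S <;> simp [h]
  rcases min_choice (min ((A ∩ S).card : ℝ) ((A \ (A ∩ S)).card : ℝ)) δ with h | h
  · rw [h]
    rcases min_choice ((A ∩ S).card : ℝ) ((A \ (A ∩ S)).card : ℝ) with h | h
    · exact ⟨0, 0, le_rfl, le_rfl, by rw [h, h0, h00]; simp⟩
    · exact ⟨1, 1, zero_le_one, zero_le_one, by rw [h, h1, h10]; simp⟩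
  · exact ⟨1, 0, zero_le_one, le_rfl, by rw [h, h10, h00]; simp⟩

/-- The mass leaving the seed set is bounded by its cut. -/
theorem IsDiffusion.massOutside_le {H : CardHypergraph V E} {γ : ℝ} (hγ : 0 ≤ γ) {S : Finset V}
    {x : Node V E → ℝ} (hx : H.IsDiffusion γ 0 S x) : γ * H.massOutside S x ≤ H.cut S := by
  have h1 := hx.flowForm_eq hγ x
  rw [flowForm_self, hx.1.1, hx.1.2.1, sub_zero, one_mul] at h1
  choose p q hp hq hpq using fun e => exists_gadget_energy_le (H.verts e) S (H.δ e)
  set y : Node V E → ℝ := Sum.elim (Sum.elim (fun v => if v ∈ S then 1 else 0) (Sum.elim p q))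
    (fun t => if t then 1 else 0) with hy
  have hyf : Feasible y := by
    refine ⟨by simp [hy], by simp [hy], ?_⟩
    rintro ((v | e | e) | (_ | _))
    · simp only [hy, Sum.elim_inl]; split_ifs <;> simp
    · exact hp e
    · exact hq e
    · simp [hy]
    · simp [hy]
  have h2 := hx.2 y hyf
  have h3 : 2 * H.objective γ 0 S y ≤ H.cut S := by
    have : 2 * H.objective γ 0 S y =
        ∑ i, ∑ j, H.locWeight γ S i j * max (y i - y j) 0 ^ 2 := by
      rw [objective]; ring
    rw [this, H.sum_locWeight_mul γ S (fun i j => max (y i - y j) 0 ^ 2)]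
    have e1 : ∑ r ∈ S, γ * H.deg r * max (y (.inr true) - y (.inl (.inl r))) 0 ^ 2 = 0 :=
      Finset.sum_eq_zero fun r hr => by simp [hy, hr]
    have e2 : ∑ v ∈ Sᶜ, γ * H.deg v * max (y (.inl (.inl v)) - y (.inr false)) 0 ^ 2 = 0 :=
      Finset.sum_eq_zero fun r hr => by simp [hy, Finset.mem_compl.1 hr]
    rw [e1, e2, add_zero, add_zero, cut]
    exact Finset.sum_le_sum fun e _ => mul_le_mul_of_nonneg_left (hpq e) (H.c_nonneg e)
  linarith

/-- Conservation of flow across a set of vertices. -/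
theorem IsDiffusion.flow_balance {H : CardHypergraph V E} {γ : ℝ} (hγ : 0 ≤ γ) {v : V}
    {x : Node V E → ℝ} (hx : H.IsDiffusion γ 0 {v} x) (hv : H.deg v * x (.inl (.inl v)) ≤ H.deg v)
    (T : Finset V) :
    γ * ∑ u ∈ T, H.deg u * x (.inl (.inl u)) +
      ∑ e, H.c e *
        (∑ u ∈ H.verts e ∩ T, max (x (.inl (.inl u)) - x (.inl (.inr (.inl e)))) 0 -
          ∑ u ∈ H.verts e ∩ T, max (x (.inl (.inr (.inr e))) - x (.inl (.inl u))) 0) =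
      if v ∈ T then γ * H.deg v else 0 := by
  have := sum_flow_eq hγ hx (Sum.elim (Sum.elim (fun u => if u ∈ T then 1 else 0) 0) 0)
  simp only [Sum.elim_inl, Sum.elim_inr, Pi.zero_apply, sub_zero, zero_sub, mul_neg,
    Finset.sum_neg_distrib, mul_zero, add_zero, zero_mul, mul_ite, mul_one,
    ← sub_eq_add_neg, ← Finset.sum_filter, Finset.filter_mem_eq_inter] at this
  -- The source supplies only `γ d_v (1 - x_v)`. Counting this as a supply `γ d_v` and a drain `γ
  -- d_v x_v` makes the seed drain like every other vertex.
  have hdv : H.deg v * max (1 - x (.inl (.inl v))) 0 = H.deg v - H.deg v * x (.inl (.inl v)) := by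
    rw [mul_max_of_nonneg _ _ (H.deg_nonneg v), mul_zero, max_eq_left] <;> linarith
  have hsum : ∑ u ∈ T, H.deg u * x (.inl (.inl u)) =
      ∑ u ∈ {v}ᶜ ∩ T, H.deg u * x (.inl (.inl u)) +
        if v ∈ T then H.deg v * x (.inl (.inl v)) else 0 := by
    split_ifs with h
    · rw [show ({v}ᶜ ∩ T : Finset V) = T.erase v by ext; simp, Finset.sum_erase_add _ _ h]
    · rw [add_zero]
      refine Finset.sum_congr ?_ fun _ _ => rfl
      ext u
      simp only [Finset.mem_inter, Finset.mem_compl, Finset.mem_singleton]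
      exact ⟨fun hu => ⟨fun huv => h (huv ▸ hu), hu⟩, fun hu => hu.2⟩
  have hγs : ∑ u ∈ {v}ᶜ ∩ T, γ * H.deg u * x (.inl (.inl u)) =
      γ * ∑ u ∈ {v}ᶜ ∩ T, H.deg u * x (.inl (.inl u)) := by
    rw [Finset.mul_sum]; exact Finset.sum_congr rfl fun _ _ => by ring
  rw [hγs] at this
  rw [hsum]
  split_ifs with h
  · rw [Finset.singleton_inter_of_mem h, Finset.sum_singleton] at this
    linear_combination this + γ * hdv
  · rw [Finset.singleton_inter_of_notMem h, Finset.sum_empty] at this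
    linear_combination this

theorem exists_edge_of_deg_pos (H : CardHypergraph V E) {v : V} (hv : 0 < H.deg v) :
    ∃ e, v ∈ H.verts e ∧ 0 < H.c e ∧ ∃ w ∈ H.verts e, w ≠ v := by
  obtain ⟨e, he, hpos⟩ := Finset.exists_lt_of_sum_lt
    (s := Finset.univ.filter fun e => v ∈ H.verts e) (f := fun _ => (0 : ℝ))
    (g := fun e => H.split e {v}) (by simpa [deg] using hv)
  refine ⟨e, (Finset.mem_filter.1 he).2, ?_, ?_⟩
  · rcases (H.c_nonneg e).eq_or_lt with h | h
    · simp [split, ← h] at hpos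
    · exact h
  · by_contra! hall
    have : H.verts e \ {v} = ∅ := by
      ext w; simpa using hall w
    simp [split, this, zero_le_one.trans (H.one_le_δ e)] at hpos

theorem deg_pos_of_mem (H : CardHypergraph V E) {e : E} (he : 0 < H.c e) {v w : V}
    (hv : v ∈ H.verts e) (hw : w ∈ H.verts e) (hne : w ≠ v) : 0 < H.deg v := by
  have h1 : H.split e {v} ≤ H.deg v :=
    Finset.single_le_sum (f := fun e => H.split e {v}) (fun e _ => H.split_nonneg e _) (by simpa)
  refine lt_of_lt_of_le (mul_pos he (lt_min (lt_min (by simp) ?_) ?_)) h1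
  · exact_mod_cast Finset.card_pos.2 ⟨w, by simp [hw, hne]⟩
  · linarith [H.one_le_δ e]

/-- Maximum principle, by testing with `(x - 1)₊`: this vanishes at source and sink, so each of its
nonnegative terms is zero and potentials above `1` cannot drop along an edge. A non-seed vertex of
positive degree has an edge to the sink, and a seed of positive degree reaches such a vertex through
a gadget. The factor `deg u` is needed because potentials at degree-zero vertices need not be
determined. -/
theorem IsDiffusion.deg_mul_le {H : CardHypergraph V E} {γ : ℝ} (hγ : 0 < γ) {v : V}
    {x : Node V E → ℝ} (hx : H.IsDiffusion γ 0 {v} x) (u : V) :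
    H.deg u * x (.inl (.inl u)) ≤ H.deg u := by
  have hδ0 := fun e => zero_le_one.trans (H.one_le_δ e)
  set z : Node V E → ℝ := fun i => max (x i - 1) 0 with hz
  have hmono : ∀ i j, 0 ≤ max (x i - x j) 0 * (z i - z j) := fun i j => by
    rcases le_total (x i) (x j) with h | h
    · rw [max_eq_right (by linarith), zero_mul]
    · exact mul_nonneg (le_max_right _ _) (sub_nonneg.2 (max_le_max_right _ (by linarith)))
  have hzero : ∀ i j, H.locWeight γ {v} i j * (max (x i - x j) 0 * (z i - z j)) = 0 := by
    have h0 := hx.flowForm_eq hγ.le z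
    have h1 : z (.inr true) = 0 := by simp [hz, hx.1.1]
    have h2 : z (.inr false) = 0 := by simp [hz, hx.1.2.1]
    rw [h1, h2, sub_zero, zero_mul, flowForm] at h0
    have hnn : ∀ i j, 0 ≤ H.locWeight γ {v} i j * (max (x i - x j) 0 * (z i - z j)) :=
      fun i j => mul_nonneg (H.locWeight_nonneg hγ.le _ i j) (hmono i j)
    intro i j
    rw [Finset.sum_eq_zero_iff_of_nonneg fun i _ => Finset.sum_nonneg fun j _ => hnn i j] at h0
    exact (Finset.sum_eq_zero_iff_of_nonneg fun j _ => hnn i j).1 (h0 i (Finset.mem_univ _)) j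
      (Finset.mem_univ _)
  have hdrop : ∀ i j, 0 < H.locWeight γ {v} i j → 1 < x i → 1 < x j ∧ x i ≤ x j := fun i j hw hi => by
    have h := (mul_eq_zero.1 (hzero i j)).resolve_left hw.ne'
    have hle : x i ≤ x j := by
      by_contra! hlt
      refine absurd h (mul_pos (lt_max_of_lt_left (by linarith)) ?_).ne'
      rw [sub_pos]
      exact max_lt (lt_max_of_lt_left (by linarith)) (lt_max_of_lt_left (by linarith))
    exact ⟨hi.trans_le hle, hle⟩
  have hne : ∀ u, u ≠ v → 0 < H.deg u → x (.inl (.inl u)) ≤ 1 := fun u hu hd => by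
    by_contra! hgt
    have := (hdrop (.inl (.inl u)) (.inr false) (by
      simp only [locWeight, Finset.mem_singleton, hu, if_false]; positivity) hgt).1
    rw [hx.1.2.1] at this
    linarith
  rcases (H.deg_nonneg u).eq_or_lt with hd | hd
  · simp [← hd]
  · refine mul_le_of_le_one_right hd.le ?_
    by_cases hu : u = v
    · subst hu
      by_contra! hgt
      obtain ⟨e, hue, hce, w, hwe, hwu⟩ := H.exists_edge_of_deg_pos hd
      have ha := (hdrop (.inl (.inl u)) (.inl (.inr (.inl e)))
        (by simp [locWeight, redWeight, hue, hce]) hgt).1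
      have hb := (hdrop (.inl (.inr (.inl e))) (.inl (.inr (.inr e)))
        (by simp [locWeight, redWeight, hce, zero_lt_one.trans_le (H.one_le_δ e)]) ha).1
      have hw := (hdrop (.inl (.inr (.inr e))) (.inl (.inl w))
        (by simp [locWeight, redWeight, hwe, hce]) hb).1
      linarith [hne w hwu (H.deg_pos_of_mem hce hwe hue hwu.symm)]
    · exact hne u hu hd

/-- The total mass of the diffusion seeded at a vertex is the degree of that vertex. -/
theorem IsDiffusion.sum_deg_mul {H : CardHypergraph V E} {γ : ℝ} (hγ : 0 < γ) {v : V}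
    {x : Node V E → ℝ} (hx : H.IsDiffusion γ 0 {v} x) :
    ∑ u, H.deg u * x (.inl (.inl u)) = H.deg v := by
  have h := hx.flow_balance hγ.le (hx.deg_mul_le hγ v) Finset.univ
  have h0 : ∀ e, H.c e *
      (∑ u ∈ H.verts e ∩ Finset.univ, max (x (.inl (.inl u)) - x (.inl (.inr (.inl e)))) 0 -
        ∑ u ∈ H.verts e ∩ Finset.univ, max (x (.inl (.inr (.inr e))) - x (.inl (.inl u))) 0) = 0 :=
    fun e => by
      rw [Finset.inter_univ]
      by_cases he : H.c e = 0
      · rw [he, zero_mul]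
      · rw [hx.gadget_in hγ.le e he, hx.gadget_out hγ.le e he, sub_self, mul_zero]
  simp only [h0, Finset.sum_const_zero, add_zero, Finset.mem_univ, if_true] at h
  exact mul_left_cancel₀ hγ.ne' h

/-! ### Exchange across a threshold set -/

/-- Each selection takes at most `min {1, |e \ {u}|, δ_e}` at `u`, the contribution of `e` to the
degree. This makes the exchange admissible in the Lovász–Simonovits comparison. -/
theorem sum_fracSelection_le_deg (H : CardHypergraph V E) {A : E → Finset V} {C : E → ℝ}
    {α : E → V → ℝ} (hα : ∀ e, IsFracSelection (A e) (C e) (α e)) (hA : ∀ e, A e ⊆ H.verts e)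
    (hδ : ∀ e, C e ≤ H.δ e) (hC : ∀ e, ∀ u ∈ A e, C e ≤ ((H.verts e \ {u}).card : ℝ)) (u : V) :
    ∑ e, H.c e * α e u ≤ H.deg u := by
  rw [deg, Finset.sum_filter]
  refine Finset.sum_le_sum fun e _ => ?_
  by_cases hu : u ∈ A e
  · rw [if_pos (hA e hu)]
    refine mul_le_mul_of_nonneg_left (le_min (le_min ?_ ?_) ?_) (H.c_nonneg e)
    · simpa using (hα e).le_one u
    · exact ((hα e).le_weight u).trans (hC e u hu)
    · exact ((hα e).le_weight u).trans (hδ e)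
  · rw [(hα e).eq_zero u hu, mul_zero]
    split_ifs
    · exact H.split_nonneg e _
    · exact le_rfl

/-- The flow across a threshold set `T` dominates a fractional exchange of total weight `cut T`
between `T` and its complement. -/
theorem IsDiffusion.exists_exchange {H : CardHypergraph V E} {γ : ℝ} (hγ : 0 < γ) {v : V}
    {x : Node V E → ℝ} (hx : H.IsDiffusion γ 0 {v} x) (T : Finset V) (τ : ℝ)
    (hT : ∀ u ∈ T, τ ≤ x (.inl (.inl u))) (hTc : ∀ u, u ∉ T → x (.inl (.inl u)) ≤ τ) :
    ∃ α β : V → ℝ, (∀ u, 0 ≤ α u ∧ α u ≤ H.deg u) ∧ (∀ u, 0 ≤ β u ∧ β u ≤ H.deg u) ∧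
      (∀ u, u ∉ T → α u = 0) ∧ (∀ u ∈ T, β u = 0) ∧ ∑ u, α u = H.cut T ∧ ∑ u, β u = H.cut T ∧
      ∑ u, α u * x (.inl (.inl u)) - ∑ u, β u * x (.inl (.inl u)) ≤
        3 * (γ * H.deg v - γ * ∑ u ∈ T, H.deg u * x (.inl (.inl u))) := by
  have hgad : ∀ e, ∃ α β : V → ℝ,
      IsFracSelection (H.verts e ∩ T)
        (min (min ((H.verts e ∩ T).card : ℝ) ((H.verts e \ T).card : ℝ)) (H.δ e)) α ∧
      IsFracSelection (H.verts e \ T)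
        (min (min ((H.verts e ∩ T).card : ℝ) ((H.verts e \ T).card : ℝ)) (H.δ e)) β ∧
      H.c e * (∑ u ∈ H.verts e ∩ T, α u * x (.inl (.inl u))
          - ∑ w ∈ H.verts e \ T, β w * x (.inl (.inl w))) ≤
        3 * (H.c e *
          (∑ u ∈ H.verts e ∩ T, max (x (.inl (.inl u)) - x (.inl (.inr (.inl e)))) 0 -
          ∑ u ∈ H.verts e ∩ T, max (x (.inl (.inr (.inr e))) - x (.inl (.inl u))) 0)) := by
    intro e
    -- Gadgets of scale `0` need not satisfy conservation, but any selection serves since both sides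
    -- vanish.
    by_cases he : H.c e = 0
    · have hC : 0 ≤ min (min ((H.verts e ∩ T).card : ℝ) ((H.verts e \ T).card : ℝ)) (H.δ e) :=
        le_min (le_min (Nat.cast_nonneg _) (Nat.cast_nonneg _))
          (zero_le_one.trans (H.one_le_δ e))
      obtain ⟨α, hα⟩ := exists_fracSelection hC ((min_le_left _ _).trans (min_le_left _ _))
      obtain ⟨β, hβ⟩ := exists_fracSelection hC ((min_le_left _ _).trans (min_le_right _ _))
      exact ⟨α, β, hα, hβ, by simp [he]⟩
    · have h1 := hx.gadget_in hγ.le e he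
      have h2 := hx.gadget_out hγ.le e he
      rw [← Finset.sum_inter_add_sum_sdiff _ T] at h1 h2
      obtain ⟨α, β, hα, hβ, h⟩ := exists_fracSelection_gadget (H.verts e ∩ T) (H.verts e \ T)
        (fun u => x (.inl (.inl u))) (H.one_le_δ e)
        (fun u hu => hT u (Finset.mem_inter.1 hu).2)
        (fun u hu => hTc u (Finset.mem_sdiff.1 hu).2) h1 h2
      exact ⟨α, β, hα, hβ, by linarith [mul_le_mul_of_nonneg_left h (H.c_nonneg e)]⟩
  choose α β hα hβ h using hgad
  have hsum : ∀ (A : E → Finset V) (C : E → ℝ) (α : E → V → ℝ),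
      (∀ e, IsFracSelection (A e) (C e) (α e)) → ∀ f : V → ℝ,
      ∑ u, (∑ e, H.c e * α e u) * f u = ∑ e, H.c e * ∑ u ∈ A e, α e u * f u := by
    intro A C α hα f
    simp only [Finset.sum_mul]
    rw [Finset.sum_comm]
    refine Finset.sum_congr rfl fun e _ => ?_
    rw [Finset.mul_sum, ← Finset.sum_subset (Finset.subset_univ (A e))
      fun u _ hu => by rw [(hα e).eq_zero u hu]; ring]
    exact Finset.sum_congr rfl fun _ _ => by ring
  have hcut : ∀ (A : E → Finset V) (α : E → V → ℝ),
      (∀ e, IsFracSelection (A e)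
        (min (min ((H.verts e ∩ T).card : ℝ) ((H.verts e \ T).card : ℝ)) (H.δ e)) (α e)) →
      ∑ u, ∑ e, H.c e * α e u = H.cut T := by
    intro A α hα
    have := hsum A _ α hα 1
    simp only [Pi.one_apply, mul_one] at this
    rw [this, cut]
    refine Finset.sum_congr rfl fun e _ => ?_
    rw [(hα e).sum_eq, split, Finset.sdiff_inter_self_left]
  have hCT : ∀ e, min (min ((H.verts e ∩ T).card : ℝ) ((H.verts e \ T).card : ℝ)) (H.δ e) ≤
      (H.verts e ∩ T).card := fun e => (min_le_left _ _).trans (min_le_left _ _)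
  have hCTc : ∀ e, min (min ((H.verts e ∩ T).card : ℝ) ((H.verts e \ T).card : ℝ)) (H.δ e) ≤
      (H.verts e \ T).card := fun e => (min_le_left _ _).trans (min_le_right _ _)
  refine ⟨fun u => ∑ e, H.c e * α e u, fun u => ∑ e, H.c e * β e u, fun u => ⟨?_, ?_⟩,
    fun u => ⟨?_, ?_⟩, fun u hu => ?_, fun u hu => ?_, hcut _ α hα, hcut _ β hβ, ?_⟩
  · exact Finset.sum_nonneg fun e _ => mul_nonneg (H.c_nonneg e) ((hα e).nonneg u)
  · refine H.sum_fracSelection_le_deg hα (fun e => Finset.inter_subset_left)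
      (fun e => min_le_right _ _) (fun e u hu => (hCTc e).trans ?_) u
    exact_mod_cast Finset.card_le_card (Finset.sdiff_subset_sdiff le_rfl
      (Finset.singleton_subset_iff.2 (Finset.mem_inter.1 hu).2))
  · exact Finset.sum_nonneg fun e _ => mul_nonneg (H.c_nonneg e) ((hβ e).nonneg u)
  · refine H.sum_fracSelection_le_deg hβ (fun e => Finset.sdiff_subset)
      (fun e => min_le_right _ _) (fun e u hu => (hCT e).trans ?_) u
    refine Nat.cast_le.2 (Finset.card_le_card fun w hw => ?_)
    rw [Finset.mem_sdiff, Finset.mem_singleton]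
    exact ⟨(Finset.mem_inter.1 hw).1, fun h =>
      (Finset.mem_sdiff.1 hu).2 (h ▸ (Finset.mem_inter.1 hw).2)⟩
  · exact Finset.sum_eq_zero fun e _ => by
      rw [(hα e).eq_zero u fun h => hu (Finset.mem_inter.1 h).2, mul_zero]
  · exact Finset.sum_eq_zero fun e _ => by
      rw [(hβ e).eq_zero u fun h => (Finset.mem_sdiff.1 h).2 hu, mul_zero]
  · have hbal := hx.flow_balance hγ.le (hx.deg_mul_le hγ v) T
    have hle : (if v ∈ T then γ * H.deg v else 0) ≤ γ * H.deg v := by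
      split_ifs
      · exact le_rfl
      · exact mul_nonneg hγ.le (H.deg_nonneg v)
    rw [hsum _ _ α hα, hsum _ _ β hβ, ← Finset.sum_sub_distrib]
    simp only [← mul_sub]
    refine (Finset.sum_le_sum fun e _ => h e).trans ?_
    rw [← Finset.mul_sum]
    linarith

/-! ### Sweep order and the Lovász–Simonovits comparison -/

theorem mem_prefixSet {σ : Fin (Fintype.card V) ≃ V} {k : ℕ} {v : V} :
    v ∈ prefixSet σ k ↔ (σ.symm v : ℕ) < k := by
  simp [prefixSet]

theorem prefixSet_zero (σ : Fin (Fintype.card V) ≃ V) : prefixSet σ 0 = ∅ := by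
  ext; simp [mem_prefixSet]

theorem prefixSet_of_card_le (σ : Fin (Fintype.card V) ≃ V) {k : ℕ} (hk : Fintype.card V ≤ k) :
    prefixSet σ k = Finset.univ := by
  ext v; simpa [mem_prefixSet] using (σ.symm v).2.trans_le hk

theorem prefixSet_succ (σ : Fin (Fintype.card V) ≃ V) (j : Fin (Fintype.card V)) :
    prefixSet σ (j + 1) = insert (σ j) (prefixSet σ j) := by
  ext v
  rw [Finset.mem_insert, mem_prefixSet, mem_prefixSet, ← Equiv.symm_apply_eq, Fin.ext_iff]
  omega

theorem notMem_prefixSet (σ : Fin (Fintype.card V) ≃ V) (j : Fin (Fintype.card V)) :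
    σ j ∉ prefixSet σ j := by
  simp [mem_prefixSet]

theorem exists_threshold [Nonempty V] {σ : Fin (Fintype.card V) ≃ V} {x : V → ℝ}
    (hσ : Antitone fun i => x (σ i)) (k : ℕ) :
    ∃ τ, (∀ u ∈ prefixSet σ k, τ ≤ x u) ∧ ∀ u, u ∉ prefixSet σ k → x u ≤ τ := by
  have hpos : 0 < Fintype.card V := Fintype.card_pos
  by_cases hk : k < Fintype.card V
  · refine ⟨x (σ ⟨k, hk⟩), fun u hu => ?_, fun u hu => ?_⟩
    · simpa using hσ (a := σ.symm u) (b := ⟨k, hk⟩) (Fin.le_def.2 (mem_prefixSet.1 hu).le)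
    · simpa using hσ (a := ⟨k, hk⟩) (b := σ.symm u) (Fin.le_def.2 (not_lt.1 (mem_prefixSet.not.1 hu)))
  · refine ⟨x (σ ⟨Fintype.card V - 1, by omega⟩), fun u _ => ?_, fun u hu => ?_⟩
    · simpa using hσ (a := σ.symm u) (b := ⟨Fintype.card V - 1, by omega⟩)
        (Fin.le_def.2 (by simp only; omega))
    · rw [prefixSet_of_card_le σ (not_lt.1 hk)] at hu
      exact absurd (Finset.mem_univ u) hu

/-- A concave bound for the masses of the prefixes of a decreasing order is a bound for the mass
of every fractional set (Lovász–Simonovits). -/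
theorem sum_mul_le_of_prefixSet (H : CardHypergraph V E) {σ : Fin (Fintype.card V) ≃ V}
    {x : V → ℝ} (hσ : Antitone fun i => x (σ i)) {U : ℝ → ℝ}
    (hU : ConcaveOn ℝ (Set.Icc 0 (H.vol Finset.univ)) U)
    (hpre : ∀ k, ∑ u ∈ prefixSet σ k, H.deg u * x u ≤ U (H.vol (prefixSet σ k)))
    {g : V → ℝ} (hg0 : ∀ u, 0 ≤ g u) (hg : ∀ u, g u ≤ H.deg u) :
    ∑ u, g u * x u ≤ U (∑ u, g u) := by
  have hmem : ∀ T, H.vol T ∈ Set.Icc 0 (H.vol Finset.univ) := fun T =>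
    ⟨H.vol_nonneg T, by linarith [H.vol_add_vol_compl T, H.vol_nonneg Tᶜ]⟩
  set s := ∑ u, g u with hs
  have hex : ∃ k, s ≤ H.vol (prefixSet σ k) :=
    ⟨Fintype.card V, by
      rw [prefixSet_of_card_le σ le_rfl]
      exact Finset.sum_le_sum fun u _ => hg u⟩
  classical
  obtain ⟨k, hk, hmin⟩ : ∃ k, s ≤ H.vol (prefixSet σ k) ∧
      ∀ j < k, H.vol (prefixSet σ j) < s :=
    ⟨Nat.find hex, Nat.find_spec hex, fun j hj => not_le.1 (Nat.find_min hex hj)⟩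
  rcases k with _ | j
  · have h0 := hpre 0
    simp only [prefixSet_zero, vol, Finset.sum_empty] at h0 hk
    have hs0 : s = 0 := le_antisymm hk (Finset.sum_nonneg fun u _ => hg0 u)
    have hg00 := (Finset.sum_eq_zero_iff_of_nonneg fun u _ => hg0 u).1 hs0
    rw [hs0, Finset.sum_eq_zero fun u hu => by rw [hg00 u hu, zero_mul]]
    exact h0
  · have hlt := hmin j (Nat.lt_succ_self j)
    have hj : j < Fintype.card V := by
      by_contra! hj
      rw [prefixSet_of_card_le σ (hj.trans (Nat.le_succ j))] at hk
      rw [prefixSet_of_card_le σ hj] at hlt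
      linarith
    have hsucc := prefixSet_succ σ ⟨j, hj⟩
    have hnot := notMem_prefixSet σ ⟨j, hj⟩
    simp only at hsucc hnot
    have hx_ge : ∀ u ∈ prefixSet σ j, x (σ ⟨j, hj⟩) ≤ x u := fun u hu => by
      simpa using hσ (a := σ.symm u) (b := ⟨j, hj⟩) (Fin.le_def.2 (mem_prefixSet.1 hu).le)
    have hx_le : ∀ u, u ∉ prefixSet σ j → x u ≤ x (σ ⟨j, hj⟩) := fun u hu => by
      simpa using hσ (a := ⟨j, hj⟩) (b := σ.symm u)
        (Fin.le_def.2 (not_lt.1 (mem_prefixSet.not.1 hu)))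
    set w := σ ⟨j, hj⟩ with hw
    set T := prefixSet σ j with hT
    have hvol : H.vol (prefixSet σ (j + 1)) = H.deg w + H.vol T := by
      rw [hsucc, vol, Finset.sum_insert hnot]; rfl
    have hmass : ∑ u ∈ prefixSet σ (j + 1), H.deg u * x u =
        H.deg w * x w + ∑ u ∈ T, H.deg u * x u := by
      rw [hsucc, Finset.sum_insert hnot]
    have hdw : 0 < H.deg w := by linarith
    -- Measured relative to `x w`, the best fractional set takes all of `T` and none of the rest.
    -- The greedy set of volume `s` is thus `T` with a fraction `θ` of `w`, where concavity
    -- interpolates between two prefixes.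
    have h1 : ∑ u, g u * (x u - x w) ≤ ∑ u ∈ T, H.deg u * (x u - x w) := by
      rw [← Finset.sum_filter_add_sum_filter_not Finset.univ (· ∈ T), Finset.filter_mem_eq_inter,
        Finset.univ_inter]
      have ha : ∑ u ∈ T, g u * (x u - x w) ≤ ∑ u ∈ T, H.deg u * (x u - x w) :=
        Finset.sum_le_sum fun u hu =>
          mul_le_mul_of_nonneg_right (hg u) (by linarith [hx_ge u hu])
      have hb : ∑ u with u ∉ T, g u * (x u - x w) ≤ 0 := Finset.sum_nonpos fun u hu =>
        mul_nonpos_of_nonneg_of_nonpos (hg0 u)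
          (by linarith [hx_le u (Finset.mem_filter.1 hu).2])
      linarith
    simp only [mul_sub, Finset.sum_sub_distrib, ← Finset.sum_mul] at h1
    set θ := (s - H.vol T) / H.deg w with hθ
    have hθ0 : 0 ≤ θ := div_nonneg (by linarith) hdw.le
    have hθ1 : θ ≤ 1 := (div_le_one hdw).2 (by linarith)
    have hθd : θ * H.deg w = s - H.vol T := by rw [hθ]; field_simp
    have hc := hU.2 (hmem T) (hmem (prefixSet σ (j + 1))) (sub_nonneg.2 hθ1) hθ0 (by ring)
    simp only [smul_eq_mul] at hc
    rw [show (1 - θ) * H.vol T + θ * H.vol (prefixSet σ (j + 1)) = s by rw [hvol]; linarith] at hc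
    have ha := mul_le_mul_of_nonneg_left (hpre j) (sub_nonneg.2 hθ1)
    have hb := mul_le_mul_of_nonneg_left (hpre (j + 1)) hθ0
    rw [hmass] at hb
    have hvT : ∑ u ∈ T, H.deg u = H.vol T := rfl
    rw [hvT] at h1
    have e : θ * (H.deg w * x w) = (s - H.vol T) * x w := by rw [← mul_assoc, hθd]
    linarith

/-- Comparison principle: a concave supersolution bounds the masses of all prefixes. -/
theorem IsDiffusion.prefix_mass_le {H : CardHypergraph V E} {γ : ℝ} (hγ : 0 < γ) {v : V}
    {x : Node V E → ℝ} (hx : H.IsDiffusion γ 0 {v} x) {σ : Fin (Fintype.card V) ≃ V}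
    (hσ : Antitone fun i => x (.inl (.inl (σ i)))) {U : ℝ → ℝ}
    (hU : ConcaveOn ℝ (Set.Icc 0 (H.vol Finset.univ)) U)
    (hsuper : ∀ k, H.cut (prefixSet σ k) ≤ H.vol (prefixSet σ k) →
      H.cut (prefixSet σ k) ≤ H.vol (prefixSet σ k)ᶜ →
      ∑ u ∈ prefixSet σ k, H.deg u * x (.inl (.inl u)) ≤ U (H.vol (prefixSet σ k)) ∨
      3 * γ * (H.deg v - U (H.vol (prefixSet σ k))) ≤ 2 * U (H.vol (prefixSet σ k))
        - U (H.vol (prefixSet σ k) - H.cut (prefixSet σ k))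
        - U (H.vol (prefixSet σ k) + H.cut (prefixSet σ k))) (k : ℕ) :
    ∑ u ∈ prefixSet σ k, H.deg u * x (.inl (.inl u)) ≤ U (H.vol (prefixSet σ k)) := by
  have : Nonempty V := ⟨v⟩
  set f : ℕ → ℝ := fun k => ∑ u ∈ prefixSet σ k, H.deg u * x (.inl (.inl u))
    - U (H.vol (prefixSet σ k)) with hf
  -- At a prefix of maximal excess `m > 0` over `U`, the shifted barrier `U + m` bounds every
  -- fractional set and is attained. Removing `α` from `T` and adding `β` to `T` then bounds the
  -- second difference of `U` by `3 γ (d_v - U - m)`, strictly less than the supersolution condition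
  -- allows.
  obtain ⟨j, -, hj⟩ := Finset.exists_max_image (Finset.range (Fintype.card V + 1)) f ⟨0, by simp⟩
  have hmax : ∀ k, f k ≤ f j := fun k => by
    by_cases hk : k ≤ Fintype.card V
    · exact hj k (by simpa [Nat.lt_succ_iff] using hk)
    · have : f k = f (Fintype.card V) := by
        simp only [hf, prefixSet_of_card_le σ le_rfl, prefixSet_of_card_le σ (not_le.1 hk).le]
      rw [this]
      exact hj _ (by simp)
  by_contra! hlt
  have hm : 0 < f j := lt_of_lt_of_le (by simp only [hf]; linarith) (hmax k)
  set m := f j with hm_def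
  set T := prefixSet σ j with hT
  have hfj : ∑ u ∈ T, H.deg u * x (.inl (.inl u)) = U (H.vol T) + m := by
    simp only [hm_def, hf, hT]; ring
  have hLS : ∀ g : V → ℝ, (∀ u, 0 ≤ g u) → (∀ u, g u ≤ H.deg u) →
      ∑ u, g u * x (.inl (.inl u)) ≤ U (∑ u, g u) + m := fun g hg0 hg =>
    H.sum_mul_le_of_prefixSet (x := fun u => x (.inl (.inl u))) (U := fun s => U s + m) hσ
      (hU.add_const m)
      (fun k => by have := hmax k; simp only [hf] at this; linarith) hg0 hg
  obtain ⟨τ, hτ1, hτ2⟩ := exists_threshold (x := fun u => x (.inl (.inl u))) hσ j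
  obtain ⟨α, β, hα, hβ, hαT, hβT, hαs, hβs, hαβ⟩ := hx.exists_exchange hγ T τ hτ1 hτ2
  have hsT : ∀ f : V → ℝ, ∑ u, (if u ∈ T then f u else 0) = ∑ u ∈ T, f u := fun f => by
    rw [← Finset.sum_filter]; simp
  have hvol : ∑ u, (if u ∈ T then H.deg u else 0) = H.vol T := hsT _
  have hmass : ∑ u, (if u ∈ T then H.deg u else 0) * x (.inl (.inl u)) =
      ∑ u ∈ T, H.deg u * x (.inl (.inl u)) := by
    simp only [ite_mul, zero_mul, hsT]
  have hα_le : ∀ u, α u ≤ if u ∈ T then H.deg u else 0 := fun u => by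
    split_ifs with h
    · exact (hα u).2
    · exact (hαT u h).le
  have hβ_le : ∀ u, β u ≤ if u ∈ Tᶜ then H.deg u else 0 := fun u => by
    by_cases h : u ∈ T
    · simp [h, hβT u h]
    · simpa [h] using (hβ u).2
  have hM1 : H.cut T ≤ H.vol T := by
    rw [← hαs, ← hvol]; exact Finset.sum_le_sum fun u _ => hα_le u
  have hM2 : H.cut T ≤ H.vol Tᶜ := by
    rw [← hβs]
    refine (Finset.sum_le_sum fun u _ => hβ_le u).trans_eq ?_
    rw [← Finset.sum_filter, vol]
    exact Finset.sum_congr (by ext; simp) fun _ _ => rfl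
  have h1 := hLS (fun u => (if u ∈ T then H.deg u else 0) - α u)
    (fun u => sub_nonneg.2 (hα_le u)) (fun u => by
      have := (hα u).1
      have := H.deg_nonneg u
      split_ifs <;> linarith)
  have h2 := hLS (fun u => (if u ∈ T then H.deg u else 0) + β u)
    (fun u => by
      have := (hβ u).1
      have := H.deg_nonneg u
      split_ifs <;> linarith)
    (fun u => by
      split_ifs with h
      · rw [hβT u h, add_zero]
      · rw [zero_add]; exact (hβ u).2)
  simp only [sub_mul, add_mul, Finset.sum_sub_distrib, Finset.sum_add_distrib, hvol, hmass, hαs,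
    hβs] at h1 h2
  rcases hsuper j hM1 hM2 with h | h
  · linarith
  · have : 0 < γ * m := mul_pos hγ hm
    rw [hfj] at hαβ h1 h2
    linarith

end

end CardHypergraph

/-! ### The logarithmic barrier -/

theorem sq_div_sq_le_log {q h : ℝ} (h0 : 0 ≤ h) (hq : h < q) :
    h ^ 2 / q ^ 2 ≤ 2 * Real.log q - Real.log (q - h) - Real.log (q + h) := by
  have hq0 : 0 < q := h0.trans_lt hq
  have h1 : 0 < q - h := by linarith
  have h2 : 0 < q + h := by linarith
  have := Real.log_le_sub_one_of_pos (x := (q - h) * (q + h) / q ^ 2) (by positivity)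
  rw [Real.log_div (by positivity) (by positivity), Real.log_mul h1.ne' h2.ne', Real.log_pow] at this
  have e : (q - h) * (q + h) / q ^ 2 - 1 = - (h ^ 2 / q ^ 2) := by field_simp; ring
  rw [e] at this
  push_cast at this
  linarith

theorem concaveOn_linear_add_log {s : Set ℝ} (hs : Convex ℝ s) {m c B p q : ℝ} (hB : 0 ≤ B)
    (hpos : ∀ k ∈ s, 0 < p + q * k) :
    ConcaveOn ℝ s fun k => m * k + c + B * Real.log (p + q * k) := by
  refine ⟨hs, fun y hy z hz a b ha hb hab => ?_⟩
  have h := strictConcaveOn_log_Ioi.concaveOn.2 (Set.mem_Ioi.2 (hpos y hy))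
    (Set.mem_Ioi.2 (hpos z hz)) ha hb hab
  simp only [smul_eq_mul] at h ⊢
  have e : a * (p + q * y) + b * (p + q * z) = p + q * (a * y + b * z) := by
    linear_combination p * hab
  rw [e] at h
  have h' := mul_le_mul_of_nonneg_left h hB
  have e2 : c = a * c + b * c := by rw [← add_mul, hab, one_mul]
  linarith

/-- The second difference of the logarithmic part of the barrier. -/
theorem barrier_second_difference {d γ L z M : ℝ} (hd : 0 < d) (hγ : 0 ≤ γ) (hL : 0 < L)
    (hz : d / 20 ≤ z) (hMz : M ≤ z) (hM : Real.sqrt (32 * γ * L) * z ≤ M) :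
    3 * γ ≤ 147 / (800 * L) * (2 * Real.log (1 + 50 / d * z) - Real.log (1 + 50 / d * (z - M))
      - Real.log (1 + 50 / d * (z + M))) := by
  have hz0 : 0 < z := by linarith
  have hM0 : 0 ≤ M := (mul_nonneg (Real.sqrt_nonneg _) hz0.le).trans hM
  have h50 : 0 < 50 / d := by positivity
  have hlog := sq_div_sq_le_log (q := 1 + 50 / d * z) (h := 50 / d * M) (by positivity)
    (by nlinarith)
  have e1 : 1 + 50 / d * z - 50 / d * M = 1 + 50 / d * (z - M) := by ring
  have e2 : 1 + 50 / d * z + 50 / d * M = 1 + 50 / d * (z + M) := by ring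
  rw [e1, e2] at hlog
  have hB : 0 < 147 / (800 * L) := by positivity
  refine le_trans ?_ (mul_le_mul_of_nonneg_left hlog hB.le)
  -- From `z ≥ d / 20` one has `50 z / d ≥ 5/2`, so the added `1` costs a factor at most `7/5`,
  -- which becomes `25/49` after squaring and inverting.
  have hq : 1 + 50 / d * z ≤ 7 / 5 * (50 / d * z) := by
    have : 1 ≤ 20 / d * z := by
      rw [div_mul_eq_mul_div, le_div_iff₀ hd]; linarith
    have e : 50 / d * z = 5 / 2 * (20 / d * z) := by ring
    rw [e]; linarith
  have hq0 : 0 < 50 / d * z := by positivity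
  have hψ : 32 * γ * L * z ^ 2 ≤ M ^ 2 := by
    have := pow_le_pow_left₀ (mul_nonneg (Real.sqrt_nonneg _) hz0.le) hM 2
    rwa [mul_pow, Real.sq_sqrt (by positivity)] at this
  have hfrac : 25 / 49 * (32 * γ * L) ≤ (50 / d * M) ^ 2 / (1 + 50 / d * z) ^ 2 := by
    rw [le_div_iff₀ (by positivity)]
    calc 25 / 49 * (32 * γ * L) * (1 + 50 / d * z) ^ 2
        ≤ 25 / 49 * (32 * γ * L) * (7 / 5 * (50 / d * z)) ^ 2 := by gcongr
      _ = (50 / d) ^ 2 * (32 * γ * L * z ^ 2) := by ring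
      _ ≤ (50 / d) ^ 2 * M ^ 2 := by gcongr
      _ = (50 / d * M) ^ 2 := by ring
  -- The coefficient `147 / (800 L)` is chosen to make this an equality.
  calc 3 * γ = 147 / (800 * L) * (25 / 49 * (32 * γ * L)) := by field_simp; ring
    _ ≤ _ := by gcongr

namespace CardHypergraph

noncomputable section

set_option linter.unusedSectionVars false

variable {V E : Type*} [Fintype V] [DecidableEq V] [Fintype E] [DecidableEq E]

/-- If all prefixes of the sweep order expand, little mass stays in a set of at most half the
volume. -/
theorem IsDiffusion.mass_lt_of_expansion {H : CardHypergraph V E} {γ : ℝ} (hγ : 0 < γ) {v : V}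
    (hd : 0 < H.deg v)
    {x : Node V E → ℝ} (hx : H.IsDiffusion γ 0 {v} x) {σ : Fin (Fintype.card V) ≃ V}
    (hσ : Antitone fun i => x (.inl (.inl (σ i)))) {S : Finset V}
    (hvol : H.vol S ≤ H.vol Finset.univ / 2) (hdS : 1 / 50 * H.deg v < H.vol S)
    (hexp : ∀ k, Real.sqrt (32 * γ * Real.log (100 * H.vol S / H.deg v)) *
      min (H.vol (prefixSet σ k)) (H.vol (prefixSet σ k)ᶜ) ≤ H.cut (prefixSet σ k)) :
    ∑ u ∈ S, H.deg u * x (.inl (.inl u)) < 3 / 4 * H.deg v := by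
  set d := H.deg v with hd_def
  set W := H.vol Finset.univ with hW
  set L := Real.log (100 * H.vol S / d) with hL_def
  have hr : 1 < 100 * H.vol S / d := by rw [lt_div_iff₀ hd]; linarith
  have hL : 0 < L := Real.log_pos hr
  have hdW : d ≤ W := H.deg_le_vol (Finset.mem_univ v)
  have hW0 : 0 < W := hd.trans_le hdW
  set B := 147 / (800 * L) with hB
  have hB0 : 0 < B := by positivity
  have h50 : 0 < 50 / d := by positivity
  set uL : ℝ → ℝ := fun k => d / W * k + d / 20 + d * B * Real.log (1 + 50 / d * k) with huL
  set uR : ℝ → ℝ := fun k => d / W * k + d / 20 +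
    d * B * Real.log (1 + 50 / d * W + -(50 / d) * k) with huR
  -- The linear term is the stationary profile of total mass `d`. The offset `d / 20` keeps the
  -- logarithms away from the ends, where `k` or the total mass `d` is the bound used. The
  -- logarithms in `uL` and `uR` supply curvature for volumes below and above `W / 2`.
  set U : ℝ → ℝ := fun k => min k (min (uL k) (uR k)) with hU_def
  have huR' : ∀ k, uR k = d / W * k + d / 20 + d * B * Real.log (1 + 50 / d * (W - k)) := fun k => by
    simp only [huR]; congr 3; ring
  have hUconc : ConcaveOn ℝ (Set.Icc 0 W) U := by
    refine (concaveOn_id (convex_Icc 0 W)).inf ((concaveOn_linear_add_log (convex_Icc 0 W)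
      (by positivity) fun k hk => ?_).inf (concaveOn_linear_add_log (convex_Icc 0 W)
      (by positivity) fun k hk => ?_))
    · have := mul_nonneg h50.le hk.1; linarith
    · have := mul_nonneg h50.le (sub_nonneg.2 hk.2); linarith
  have hmassv : ∀ T : Finset V, ∑ u ∈ T, H.deg u * x (.inl (.inl u)) ≤ H.vol T := fun T =>
    Finset.sum_le_sum fun u _ => hx.deg_mul_le hγ u
  have hmassd : ∀ T : Finset V, ∑ u ∈ T, H.deg u * x (.inl (.inl u)) ≤ d := fun T => by
    rw [hd_def, ← hx.sum_deg_mul hγ]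
    exact Finset.sum_le_sum_of_subset_of_nonneg (Finset.subset_univ T)
      fun u _ _ => mul_nonneg (H.deg_nonneg u) (hx.1.2.2 _)
  have hlog0 : ∀ z, 0 ≤ z → 0 ≤ d * B * Real.log (1 + 50 / d * z) := fun z hz =>
    mul_nonneg (by positivity) (Real.log_nonneg (by have := mul_nonneg h50.le hz; linarith))
  have hlog_mono : ∀ y z, 0 ≤ y → y ≤ z →
      d * B * Real.log (1 + 50 / d * y) ≤ d * B * Real.log (1 + 50 / d * z) := fun y z hy hyz => by
    have := mul_nonneg h50.le hy
    gcongr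
  have hpre := hx.prefix_mass_le hγ hσ hUconc (fun k hM1 hM2 => by
    set T := prefixSet σ k with hT
    have hcompl : H.vol Tᶜ = W - H.vol T := by linarith [H.vol_add_vol_compl T]
    have hexpT := hexp k
    rw [← hT, hcompl] at hexpT
    rw [hcompl] at hM2
    have hk0 := H.vol_nonneg T
    have hkW : H.vol T ≤ W := by linarith [H.vol_nonneg Tᶜ]
    set K := H.vol T with hK
    set M := H.cut T with hM_def
    have hdWk : 0 ≤ d / W * K := by positivity
    have hUle : ∀ s, U s ≤ uL s ∧ U s ≤ uR s := fun s =>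
      ⟨(min_le_right _ _).trans (min_le_left _ _), (min_le_right _ _).trans (min_le_right _ _)⟩
    by_cases hUK : U K = K
    · exact Or.inl ((hmassv T).trans_eq hUK.symm)
    rcases le_total K (W - K) with hhalf | hhalf
    · have hLR : uL K ≤ uR K := by
        rw [huR']
        simp only [huL]
        linarith [hlog_mono K (W - K) hk0 hhalf]
      have hUK' : U K = uL K := by
        simp only [hU_def, min_eq_left hLR] at hUK ⊢
        exact (min_choice _ _).resolve_left hUK
      have hle : uL K ≤ K := hUK' ▸ min_le_left _ _
      have hz : d / 20 ≤ K := by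
        simp only [huL] at hle
        linarith [hlog0 K hk0]
      rw [min_eq_left hhalf] at hexpT
      have key := mul_le_mul_of_nonneg_left
        (barrier_second_difference hd hγ.le hL hz hM1 hexpT) hd.le
      have hUnn : 0 ≤ U K := by
        rw [hUK']
        simp only [huL]
        linarith [hlog0 K hk0]
      right
      have := mul_nonneg hγ.le hUnn
      have a1 := (hUle (K - M)).1
      have a2 := (hUle (K + M)).1
      rw [hUK'] at this ⊢
      simp only [huL] at a1 a2 this ⊢
      linarith
    · have hRL : uR K ≤ uL K := by
        rw [huR']
        simp only [huL]
        linarith [hlog_mono (W - K) K (by linarith) hhalf]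
      have hUK' : U K = uR K := by
        simp only [hU_def, min_eq_right hRL] at hUK ⊢
        exact (min_choice _ _).resolve_left hUK
      -- Near full volume the trivial bound by the total mass `d` suffices; otherwise the complement
      -- has volume at least `d / 20`, as the second-difference estimate requires.
      by_cases hRd : d ≤ uR K
      · left
        rw [hUK']
        exact (hmassd T).trans hRd
      push Not at hRd
      have hz : d / 20 ≤ W - K := by
        rw [huR'] at hRd
        have h1 : d / W * K + d / 20 < d := by linarith [hlog0 (W - K) (by linarith)]
        have h2 : d / W * K = d - d / W * (W - K) := by field_simp; ring
        have h3 : d / W * (W - K) ≤ 1 * (W - K) :=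
          mul_le_mul_of_nonneg_right ((div_le_one hW0).2 hdW) (by linarith)
        linarith
      rw [min_eq_right hhalf] at hexpT
      have key := mul_le_mul_of_nonneg_left
        (barrier_second_difference hd hγ.le hL hz hM2 hexpT) hd.le
      have hUnn : 0 ≤ U K := by
        rw [hUK', huR']
        linarith [hlog0 (W - K) (by linarith)]
      right
      have := mul_nonneg hγ.le hUnn
      have a1 := (hUle (K - M)).2
      have a2 := (hUle (K + M)).2
      rw [huR'] at a1 a2
      rw [hUK', huR'] at this ⊢
      rw [show W - (K - M) = W - K + M by ring] at a1
      rw [show W - (K + M) = W - K - M by ring] at a2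
      linarith)
  have hS := H.sum_mul_le_of_prefixSet (x := fun u => x (.inl (.inl u))) hσ hUconc hpre
    (g := fun u => if u ∈ S then H.deg u else 0)
    (fun u => by split_ifs; exacts [H.deg_nonneg u, le_rfl])
    (fun u => by split_ifs; exacts [le_rfl, H.deg_nonneg u])
  simp only [ite_mul, zero_mul, ← Finset.sum_filter, Finset.filter_mem_eq_inter,
    Finset.univ_inter] at hS
  have hUS : U (H.vol S) ≤ uL (H.vol S) := (min_le_right _ _).trans (min_le_left _ _)
  have hlogL : Real.log (1 + 50 / d * H.vol S) ≤ L := by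
    refine Real.log_le_log (by have := mul_nonneg h50.le (H.vol_nonneg S); linarith) ?_
    have : 1 ≤ 50 / d * H.vol S := by
      rw [div_mul_eq_mul_div, le_div_iff₀ hd]; linarith
    have e : 100 * H.vol S / d = 2 * (50 / d * H.vol S) := by ring
    rw [e]; linarith
  have hBL : B * L = 147 / 800 := by rw [hB]; field_simp
  have h1 : d * B * Real.log (1 + 50 / d * H.vol S) ≤ d * (147 / 800) := by
    rw [← hBL, ← mul_assoc]; gcongr
  have h2 : d / W * H.vol S ≤ d / 2 := by
    rw [div_mul_eq_mul_div, div_le_iff₀ hW0]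
    nlinarith
  have hvS : ∑ u ∈ S, H.deg u = H.vol S := rfl
  rw [hvS] at hS
  simp only [huL] at hUS
  -- The three parts of `uL` at `vol S` add up to at most `(1/2 + 1/20 + 147/800) d`, which is less
  -- than `3/4 * d`.
  linarith

/-! ### Existence and conductance of sweep cuts -/

theorem cut_eq_zero_or_one_le_deltaBar (H : CardHypergraph V E) (T : Finset V) :
    H.cut T = 0 ∨ 1 ≤ H.deltaBar T := by
  rcases (H.boundary T).eq_empty_or_nonempty with h | ⟨e, he⟩
  · left
    refine Finset.sum_eq_zero fun e _ => ?_
    have hδ := zero_le_one.trans (H.one_le_δ e)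
    have he : e ∉ H.boundary T := by simp [h]
    simp only [boundary, Finset.mem_filter, Finset.mem_univ, true_and, not_and_or,
      Finset.not_nonempty_iff_eq_empty] at he
    rcases he with he | he
    · simp [split, he, hδ]
    · have : H.verts e \ T = ∅ := by rw [Finset.sdiff_eq_inter_compl, he]
      simp [split, Finset.sdiff_inter_self_left, this, hδ]
  · right
    refine le_trans (le_min (H.one_le_δ e) ?_)
      (le_ciSup (f := fun e : H.boundary T => min (H.δ e) (((H.verts e).card : ℝ) / 2))
        (Set.finite_range _).bddAbove ⟨e, he⟩)
    simp only [boundary, Finset.mem_filter, Finset.mem_univ, true_and] at he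
    have h2 : 2 ≤ (H.verts e).card := by
      rw [← Finset.card_inter_add_card_sdiff (H.verts e) T, Finset.sdiff_eq_inter_compl]
      have := Finset.card_pos.2 he.1
      have := Finset.card_pos.2 he.2
      omega
    rw [le_div_iff₀ two_pos]
    exact_mod_cast (by omega : 1 * 2 ≤ (H.verts e).card)

/-- The first prefix of positive volume owes all of it to one vertex. That vertex misses either `S`
or its complement, so the rest of the graph still has positive volume. -/
theorem exists_isSweepCut (H : CardHypergraph V E) (x : Node V E → ℝ) {S : Finset V}
    (hS : 0 < H.vol S) (hSc : 0 < H.vol Sᶜ) : ∃ T, H.IsSweepCut x T := by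
  classical
  set e : Fin (Fintype.card V) ≃ V := (Fintype.equivFin V).symm
  set f : Fin (Fintype.card V) → ℝ := fun i => - x (.inl (.inl (e i))) with hf
  set σ : Fin (Fintype.card V) ≃ V := (Tuple.sort f).trans e with hσ
  have hanti : Antitone fun i => x (.inl (.inl (σ i))) := fun i j hij => by
    have := Tuple.monotone_sort f hij
    simp only [hf, Function.comp_apply, neg_le_neg_iff] at this
    exact this
  have hfull : H.vol (prefixSet σ (Fintype.card V)) = H.vol Finset.univ := by
    rw [prefixSet_of_card_le σ le_rfl]
  have hW := H.vol_add_vol_compl S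
  have hex : ∃ k, 0 < H.vol (prefixSet σ k) := ⟨Fintype.card V, by rw [hfull]; linarith⟩
  obtain ⟨k, hk, hmin⟩ : ∃ k, 0 < H.vol (prefixSet σ k) ∧ ∀ j < k, H.vol (prefixSet σ j) ≤ 0 :=
    ⟨Nat.find hex, Nat.find_spec hex, fun j hj => not_lt.1 (Nat.find_min hex hj)⟩
  have hkc : 0 < H.vol (prefixSet σ k)ᶜ := by
    rcases k with _ | j
    · simp [prefixSet_zero, vol] at hk
    have h0 := hmin j (Nat.lt_succ_self j)
    have hj : j < Fintype.card V := by
      by_contra! hj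
      rw [prefixSet_of_card_le σ hj] at h0
      linarith
    have hv : H.vol (prefixSet σ (j + 1)) = H.deg (σ ⟨j, hj⟩) + H.vol (prefixSet σ j) := by
      rw [prefixSet_succ σ ⟨j, hj⟩, vol, Finset.sum_insert (notMem_prefixSet σ ⟨j, hj⟩)]; rfl
    have hc := H.vol_add_vol_compl (prefixSet σ (j + 1))
    by_cases hw : σ ⟨j, hj⟩ ∈ S
    · linarith [H.deg_le_vol hw]
    · linarith [H.deg_le_vol (Finset.mem_compl.2 hw)]
  have hkn : ∀ k, 0 < H.vol (prefixSet σ k)ᶜ → k < Fintype.card V := fun k hk => by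
    by_contra! h
    simp [prefixSet_of_card_le σ h, vol] at hk
  obtain ⟨m, hm, hmm⟩ := Finset.exists_min_image
    ((Finset.range (Fintype.card V)).filter fun k =>
      0 < H.vol (prefixSet σ k) ∧ 0 < H.vol (prefixSet σ k)ᶜ)
    (fun k => H.conductance (prefixSet σ k)) ⟨k, by simp [hkn k hkc, hk, hkc]⟩
  obtain ⟨-, hm1, hm2⟩ := Finset.mem_filter.1 hm
  exact ⟨prefixSet σ m, σ, hanti, ⟨m, rfl⟩, hm1, hm2, fun k h1 h2 =>
    hmm k (by simp [hkn k h2, h1, h2])⟩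

/-- Every sweep cut over a diffusion which keeps three quarters of its mass in a set of at most
half the volume has small conductance. -/
theorem IsDiffusion.conductance_sweepCut_le {H : CardHypergraph V E} {γ : ℝ} (hγ : 0 < γ) {v : V}
    (hd : 0 < H.deg v) {x : Node V E → ℝ} (hx : H.IsDiffusion γ 0 {v} x) {S : Finset V}
    (hvol : H.vol S ≤ H.vol Finset.univ / 2)
    (hmass : 3 / 4 * H.deg v ≤ ∑ u ∈ S, H.deg u * x (.inl (.inl u)))
    {T : Finset V} (hT : H.IsSweepCut x T) :
    H.conductance T ≤
      H.deltaBar T * Real.sqrt (32 * γ * Real.log (100 * H.vol S / H.deg v)) := by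
  obtain ⟨σ, hσ, -, hT1, hT2, hTmin⟩ := hT
  by_contra! hlt
  set ψ := Real.sqrt (32 * γ * Real.log (100 * H.vol S / H.deg v)) with hψ
  have hψ0 : 0 ≤ ψ := Real.sqrt_nonneg _
  -- Since `deltaBar` is at least `1` unless the cut vanishes, a failure of the bound forces
  -- conductance at least `ψ` at `T`, hence at every admissible prefix by minimality.
  have hψT : ψ ≤ H.conductance T := by
    rcases H.cut_eq_zero_or_one_le_deltaBar T with h | h
    · have hδ : 0 ≤ H.deltaBar T := Real.iSup_nonneg fun e =>
        le_min (zero_le_one.trans (H.one_le_δ e)) (by positivity)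
      rw [conductance, h, zero_div] at hlt
      linarith [mul_nonneg hδ hψ0]
    · linarith [mul_le_mul_of_nonneg_right h hψ0]
  have hdS : 1 / 50 * H.deg v < H.vol S := by
    have : ∑ u ∈ S, H.deg u * x (.inl (.inl u)) ≤ H.vol S :=
      Finset.sum_le_sum fun u _ => hx.deg_mul_le hγ u
    linarith
  refine absurd hmass (not_le.2 (hx.mass_lt_of_expansion hγ hd hσ hvol hdS fun k => ?_))
  rcases (H.vol_nonneg (prefixSet σ k)).eq_or_lt with h1 | h1
  · rw [← h1, min_eq_left (H.vol_nonneg _), mul_zero]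
    exact H.cut_nonneg _
  rcases (H.vol_nonneg (prefixSet σ k)ᶜ).eq_or_lt with h2 | h2
  · rw [← h2, min_eq_right h1.le, mul_zero]
    exact H.cut_nonneg _
  rw [← le_div_iff₀ (lt_min h1 h2)]
  exact hψT.trans (hTmin k h1 h2)

end

end CardHypergraph

/-! ### Random seeds and conclusion -/

/-- Markov's inequality for a distribution on a finite type. -/
theorem PMF.half_le_toOuterMeasure_of_sum_le {α : Type*} [Fintype α] (P : PMF α) {g : α → ℝ}
    (hg : ∀ a, 0 ≤ g a) {r : ℝ} (hr : 0 < r) (hsum : ∑ a, (P a).toReal * g a ≤ r / 2) {s : Set α}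
    (hs : ∀ a ∈ P.support, g a ≤ r → a ∈ s) : 1 / 2 ≤ P.toOuterMeasure s := by
  classical
  have htot : ∑ a, (P a).toReal = 1 := by
    rw [← ENNReal.toReal_sum fun a _ => P.apply_ne_top a, ← tsum_fintype (L := .unconditional _),
      P.tsum_coe, ENNReal.toReal_one]
  have hbad : r * ∑ a, (if a ∈ s then 0 else (P a).toReal) ≤ r / 2 := by
    refine le_trans ?_ hsum
    rw [Finset.mul_sum]
    refine Finset.sum_le_sum fun a _ => ?_
    split_ifs with h
    · rw [mul_zero]
      exact mul_nonneg ENNReal.toReal_nonneg (hg a)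
    · by_cases ha : a ∈ P.support
      · rw [mul_comm]
        exact mul_le_mul_of_nonneg_left (not_le.1 fun h' => h (hs a ha h')).le
          ENNReal.toReal_nonneg
      · rw [P.apply_eq_zero_iff a |>.2 ha]
        simp
  have hgood : 1 / 2 ≤ ∑ a, (if a ∈ s then (P a).toReal else 0) := by
    have : ∑ a, (if a ∈ s then (P a).toReal else 0) + ∑ a, (if a ∈ s then 0 else (P a).toReal)
        = 1 := by
      rw [← htot, ← Finset.sum_add_distrib]
      exact Finset.sum_congr rfl fun a _ => by split_ifs <;> simp
    have h2 : ∑ a, (if a ∈ s then 0 else (P a).toReal) ≤ 1 / 2 :=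
      le_of_mul_le_mul_left (by linarith) hr
    linarith
  rw [PMF.toOuterMeasure_apply_fintype]
  have hne : ∑ a, s.indicator P a ≠ ⊤ := ENNReal.sum_ne_top.2 fun a _ => by
    rw [Set.indicator_apply]
    split_ifs
    exacts [P.apply_ne_top a, ENNReal.zero_ne_top]
  rw [← ENNReal.toReal_le_toReal (by simp) hne,
    ENNReal.toReal_sum fun a ha => ENNReal.sum_ne_top.1 hne a ha]
  refine le_trans (by simp) (hgood.trans_eq (Finset.sum_congr rfl fun a _ => ?_))
  rw [Set.indicator_apply]
  split_ifs <;> simp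

theorem theorem5 {V E : Type*} [Fintype V] [DecidableEq V] [Fintype E] [DecidableEq E]
    (H : CardHypergraph V E) (γ c : ℝ) (hγ : 0 < γ) (hc : 0 < c)
    (S : Finset V) (hS : 0 < H.vol S) (hvol : H.vol S ≤ H.vol Finset.univ / 2)
    (hcond : H.conductance S ≤ γ / (8 * c))
    (x : Finset V → CardHypergraph.Node V E → ℝ)
    (hx : ∀ R : Finset V, H.IsDiffusion γ 0 R (x R))
    (P : PMF V) (hP : H.IsGoodSampling c S x P) :
    1 / 2 ≤ P.toOuterMeasure {v : V |
      (∃ T : Finset V, H.IsSweepCut (x {v}) T) ∧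
      ∀ T : Finset V, H.IsSweepCut (x {v}) T →
        H.conductance T ≤
          H.deltaBar T * Real.sqrt (32 * γ * Real.log (100 * H.vol S / H.deg v))} := by
  have hW := H.vol_add_vol_compl S
  have hSc : H.vol S ≤ H.vol Sᶜ := by linarith
  have hmo : γ * H.massOutside S (x S) ≤ γ / (8 * c) * H.vol S := by
    refine ((hx S).massOutside_le hγ.le).trans ?_
    rwa [CardHypergraph.conductance, min_eq_left hSc, div_le_iff₀ hS] at hcond
  -- The `8` in the conductance hypothesis makes the expected escaping fraction at most `1/8`, half
  -- of the level `1/4` used in Markov's inequality.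
  have hmo' : c / H.vol S * H.massOutside S (x S) ≤ 1 / 4 / 2 := by
    have h1 : H.massOutside S (x S) ≤ H.vol S / (8 * c) := by
      refine le_of_mul_le_mul_left (hmo.trans_eq ?_) hγ
      ring
    calc c / H.vol S * H.massOutside S (x S) ≤ c / H.vol S * (H.vol S / (8 * c)) := by gcongr
      _ = 1 / 4 / 2 := by field_simp; norm_num
  refine P.half_le_toOuterMeasure_of_sum_le (fun v => ?_) (by norm_num : (0 : ℝ) < 1 / 4)
    (hP.2.trans hmo') fun v hv hle => ⟨H.exists_isSweepCut _ hS (hS.trans_le hSc), fun T hT => ?_⟩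
  · exact mul_nonneg (one_div_nonneg.2 (H.deg_nonneg v)) (Finset.sum_nonneg fun u _ =>
      mul_nonneg (H.deg_nonneg u) ((hx {v}).1.2.2 _))
  · have hd := hP.1 v hv
    refine (hx {v}).conductance_sweepCut_le hγ hd hvol ?_ hT
    rw [one_div_mul_eq_div, div_le_iff₀ hd] at hle
    have htot := (hx {v}).sum_deg_mul hγ
    rw [← Finset.sum_add_sum_compl S] at htot
    simp only [CardHypergraph.massOutside] at hle
    linarith
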